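/- **Setting.** Let $d\ge 0$, $P,D\ge 1$ and $T$ be integers. For $t=1,\dots,T$ let $x_t\in\mathbb R^d$ with $\|x_t\|\le 1$, and $y_t\in\mathbb R$. Let $\mathcal C(\cdot,y_t):\mathbb R\to\mathbb R$ be convex, let $\Omega:[0,\infty)\to\mathbb R$ be convex and nondecreasing, and let $\lambda\ge 0$. For $p=1,\dots,P$ let $\kappa_p$ be a shift-invariant positive semidefinite kernel on $\mathbb R^d$ with $\kappa_p(x,x)=1$ and $\kappa_p\le 1$, let $\mathcal H_p$ be its RKHS, and let $\pi_p$ be its spectral distribution, i.e. the probability measure with $\kappa_p(x,x')=\mathbb E_{v\sim\pi_p}e^{\mathrm i v^\top(x-x')}$; put $\sigma_p^2=\mathbb E_{v\sim\pi_p}\|v\|^2\in[0,\infty]$. For each $p$ draw $v_{p,1},\dots,v_{p,D}$ i.i.d. from $\pi_p$ and set $$z_p(x)=\tfrac1{\sqrt D}\big[\sin(v_{p,1}^\top x),\dots,\sin(v_{p,D}^\top x),\cos(v_{p,1}^\top x),\dots,\cos(v_{p,D}^\top x)\big]^\top\in\mathbb R^{2D}.$$ The loss in slot $t$ of $f\in\mathcal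 H_p$ is $\mathcal L_t(f(x_t))=\mathcal C(f(x_t),y_t)+\lambda\Omega(\|f\|_{\mathcal H_p}^2)$, that of $\hat f=\theta^\top z_p(\cdot)$ is $\mathcal L_t(\hat f(x_t))=\mathcal C(\theta^\top z_p(x_t),y_t)+\lambda\Omega(\|\theta\|^2)$ (hence convex in $\theta$), and that of $\sum_p \bar w_p\theta_p^\top z_p(\cdot)$ is $\mathcal C(\sum_p\bar w_p\theta_p^\top z_p(x_t),y_t)+\lambda\Omega(\sum_p\|\bar w_p\theta_p\|^2)$. **Raker** with step size $\eta>0$: $\theta_{p,1}=0$, $w_{p,1}=1/P$; for $t=1,\dots,T$, with $\hat f_{p,t}=\theta_{p,t}^\top z_p(\cdot)$ and $\bar w_{p,t}=w_{p,t}/\sum_q w_{q,t}$, it incurs $\mathcal L_t\big(\sum_p\bar w_{p,t}\hat f_{p,t}(x_t)\big)$ and updates $\theta_{p,t+1}=\theta_{p,t}-\eta\nabla_\theta\mathcal L_t(\hat f_{p,t}(x_t))$ and $w_{p,t+1}=w_{p,t}\exp(-\eta\,\mathcal L_t(\hat f_{p,t}(x_t)))$. Here $\nabla_\theta$ is the gradient,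 formed by the chain rule; where $\mathcal C(\cdot,y_t)$ or $\Omega$ is not differentiable, any fixed choice of subderivative is used. **Bounded losses and gradients.** Let $L,C_\theta$ be such that, for every $t\le T$, every realization of the random features and every $\theta$ with $\|\theta\|\le C_\theta$, the loss of $\theta^\top z_p(\cdot)$ in slot $t$ lies in $[-1,1]$ and its (sub)gradient in $\theta$ has norm at most $L$. Assume that almost surely $\|\theta_{p,t}\|\le C_\theta$ for all $p$ and all $t\le T$. **Best functions.** For each $p$ let $f_p^*=\sum_{t=1}^T\alpha_{p,t}^*\kappa_p(\cdot,x_t)$ minimize $\sum_{t=1}^T\mathcal L_t(f(x_t))$ over $f\in\mathcal H_p$, and let $C$ be a constant with $\max_p\sum_{t=1}^T|\alpha_{p,t}^*|\le C\le C_\theta$. **Theorem.** Let $\epsilon>0$. For every $p$, with probability at least $1-2^8(\sigma_p/\epsilon)^2\exp\!\big(\frac{-D\epsilon^2}{4d+8}\big)$, $$\sum_{t=1}^T\mathcal L_t\Big(\sum_{q=1}^P\bar w_{q,t}\hat f_{q,t}(x_t)\Big)-\sum_{t=1}^T\mathcal L_t(f_p^*(x_t))\le\frac{\ln P}{\eta}+\frac{(1+\epsilon)C^2}{2\eta}+\frac{\eta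 L^2T}{2}+\eta T+\epsilon LTC .$$ In particular, if $p$ is an index at which $\min_{q}\sum_{t}\mathcal L_t(f_q^*(x_t))$ is attained, then with that probability the same bound holds with $\min_{q}\sum_{t}\mathcal L_t(f_q^*(x_t))$ in place of $\sum_t\mathcal L_t(f_p^*(x_t))$. Moreover, if $T\ge1$, $\eta=\epsilon$ and $a/\sqrt T\le\eta\le b/\sqrt T$ with $a>0$, then with that probability (for this minimizing $p$) the static regret satisfies $$\sum_{t=1}^T\mathcal L_t\Big(\sum_{q}\bar w_{q,t}\hat f_{q,t}(x_t)\Big)-\min_{q}\sum_{t=1}^T\mathcal L_t(f_q^*(x_t))\le c_0\sqrt T,$$ where $c_0$ depends only on $P,L,C,a,b$; that is, the static regret is $O(\sqrt T)$. -/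

import Mathlib

open MeasureTheory ProbabilityTheory Finset
open scoped BigOperators InnerProductSpace ENNReal

noncomputable section

namespace Raker

/-- The space of `2D`-dimensional random-feature / weight vectors: the left summand indexes the
sine features, the right summand the cosine features. -/
abbrev FeatureSpace (D : ℕ) : Type := EuclideanSpace ℝ (Fin D ⊕ Fin D)

/-- The real random-feature vector
`z_V(x) = D^{-1/2} [sin(v₁ᵀx), …, sin(v_Dᵀx), cos(v₁ᵀx), …, cos(v_Dᵀx)]ᵀ`. -/
def features {d D : ℕ} (v : Fin D → EuclideanSpace ℝ (Fin d)) (x : EuclideanSpace ℝ (Fin d)) :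
    FeatureSpace D :=
  WithLp.toLp 2 (Sum.elim
    (fun i => (Real.sqrt D)⁻¹ * Real.sin ⟪v i, x⟫_ℝ)
    (fun i => (Real.sqrt D)⁻¹ * Real.cos ⟪v i, x⟫_ℝ))

/-- The data of an online (regularized) function-learning task on `ℝ^d`. Slots are numbered from
`0`, so that a horizon `T` means the slots `0, …, T - 1`. -/
structure Task (d : ℕ) where
  /-- the input revealed in each slot -/
  x : ℕ → EuclideanSpace ℝ (Fin d)
  /-- the label revealed in each slot -/
  y : ℕ → ℝ
  /-- the cost `cost u y` of predicting `u` when the label is `y` -/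
  cost : ℝ → ℝ → ℝ
  /-- the derivative of `cost` in its first argument (a subderivative where there is a kink) -/
  dcost : ℝ → ℝ → ℝ
  /-- the regularization weight -/
  lam : ℝ
  /-- the regularizer, applied to a squared norm -/
  reg : ℝ → ℝ
  /-- the derivative of `reg` (a subderivative where there is a kink) -/
  dreg : ℝ → ℝ

namespace Task

variable {d : ℕ} (M : Task d)

/-- The loss in slot `t` of the random-feature function `θᵀ z_V(·)`, as a function of `θ`:
`cost(θᵀ z_V(x_t), y_t) + lam * reg(‖θ‖²)`. -/
def rfLoss {D : ℕ} (v : Fin D → EuclideanSpace ℝ (Fin d)) (t : ℕ) (θ : FeatureSpace D) : ℝ :=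
  M.cost ⟪θ, features v (M.x t)⟫_ℝ (M.y t) + M.lam * M.reg (‖θ‖ ^ 2)

/-- The (sub)gradient in `θ` of the loss in slot `t`, by the chain rule. -/
def rfGrad {D : ℕ} (v : Fin D → EuclideanSpace ℝ (Fin d)) (t : ℕ) (θ : FeatureSpace D) :
    FeatureSpace D :=
  M.dcost ⟪θ, features v (M.x t)⟫_ℝ (M.y t) • features v (M.x t) +
    (2 * M.lam * M.dreg (‖θ‖ ^ 2)) • θ

/-- Where `cost` and `reg` are differentiable, `rfGrad` is the gradient of `rfLoss`. -/
theorem hasGradientAt_rfLoss {D : ℕ} (v : Fin D → EuclideanSpace ℝ (Fin d)) (t : ℕ)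
    (θ : FeatureSpace D)
    (hc : HasDerivAt (fun u => M.cost u (M.y t))
      (M.dcost ⟪θ, features v (M.x t)⟫_ℝ (M.y t)) ⟪θ, features v (M.x t)⟫_ℝ)
    (hr : HasDerivAt M.reg (M.dreg (‖θ‖ ^ 2)) (‖θ‖ ^ 2)) :
    HasGradientAt (M.rfLoss v t) (M.rfGrad v t θ) θ := by
  rw [hasGradientAt_iff_hasFDerivAt]
  have h1 : HasFDerivAt (fun θ : FeatureSpace D => ⟪θ, features v (M.x t)⟫_ℝ)
      (innerSL ℝ (features v (M.x t))) θ := by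
    have h := (innerSL ℝ (features v (M.x t))).hasFDerivAt (x := θ)
    refine h.congr_of_eventuallyEq (Filter.Eventually.of_forall fun θ' => ?_)
    simp [real_inner_comm]
  have h2 : HasFDerivAt (fun θ : FeatureSpace D => ‖θ‖ ^ 2) (2 • innerSL ℝ θ) θ :=
    (hasStrictFDerivAt_norm_sq θ).hasFDerivAt
  have h3 := (hc.comp_hasFDerivAt θ h1).add ((hr.comp_hasFDerivAt θ h2).const_mul M.lam)
  refine h3.congr_fderiv ?_
  ext w
  simp [rfGrad]
  ring

/-- Online gradient descent on the random-feature losses with step size `η`, started at `0`. -/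
def theta {D : ℕ} (v : Fin D → EuclideanSpace ℝ (Fin d)) (η : ℝ) : ℕ → FeatureSpace D
  | 0 => 0
  | t + 1 => theta v η t - η • M.rfGrad v t (theta v η t)

/-- The unnormalized kernel weights: `1/P` at the start, then the multiplicative update
`w_{p,t+1} = w_{p,t} exp(-η L_t(f̂_{p,t}(x_t)))`. -/
def weight {P D : ℕ} (v : Fin P → Fin D → EuclideanSpace ℝ (Fin d)) (η : ℝ) :
    ℕ → Fin P → ℝ
  | 0, _ => 1 / (P : ℝ)
  | t + 1, p =>
      weight v η t p * Real.exp (-η * M.rfLoss (v p) t (M.theta (v p) η t))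

/-- The normalized kernel weights. -/
def nweight {P D : ℕ} (v : Fin P → Fin D → EuclideanSpace ℝ (Fin d)) (η : ℝ) (t : ℕ)
    (p : Fin P) : ℝ :=
  M.weight v η t p / ∑ q, M.weight v η t q

/-- The loss incurred by Raker in slot `t`, that is, the loss of `∑_p w̄_{p,t} f̂_{p,t}`. This
function is an element of the Hilbert direct sum of the `P` random-feature spaces, with components
`w̄_{p,t} θ_{p,t}`; its norm in the direct sum enters the regularizer. -/
def rakerLoss {P D : ℕ} (v : Fin P → Fin D → EuclideanSpace ℝ (Fin d)) (η : ℝ) (t : ℕ) : ℝ :=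
  M.cost (∑ p, M.nweight v η t p * ⟪M.theta (v p) η t, features (v p) (M.x t)⟫_ℝ) (M.y t) +
    M.lam * M.reg (∑ p, ‖M.nweight v η t p • M.theta (v p) η t‖ ^ 2)

/-- The cumulative loss of Raker over `T` slots. -/
def rakerTotal {P D : ℕ} (v : Fin P → Fin D → EuclideanSpace ℝ (Fin d)) (η : ℝ) (T : ℕ) : ℝ :=
  ∑ t ∈ range T, M.rakerLoss v η t

/-- The cumulative loss over `T` slots of a function `f` of the reproducing kernel Hilbert space
`H`: `∑_t (cost(f(x_t), y_t) + lam * reg(‖f‖_H²))`. -/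
def rkhsTotal {H : Type*} [NormedAddCommGroup H] [InnerProductSpace ℝ H]
    [RKHS ℝ H (EuclideanSpace ℝ (Fin d)) ℝ] (T : ℕ) (f : H) : ℝ :=
  ∑ t ∈ range T, (M.cost (f (M.x t)) (M.y t) + M.lam * M.reg (‖f‖ ^ 2))

/-- Convexity of the losses up to the horizon: the cost is convex in the prediction, the
regularizer is convex and nondecreasing on `[0, ∞)`, and `dcost`, `dreg` are (sub)derivatives. -/
structure ConvexLoss (T : ℕ) : Prop where
  cost_convex : ∀ t < T, ConvexOn ℝ Set.univ (fun u => M.cost u (M.y t))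
  dcost_spec : ∀ t < T, ∀ u u' : ℝ,
    M.cost u (M.y t) + M.dcost u (M.y t) * (u' - u) ≤ M.cost u' (M.y t)
  lam_nonneg : 0 ≤ M.lam
  reg_convex : ConvexOn ℝ (Set.Ici 0) M.reg
  reg_mono : MonotoneOn M.reg (Set.Ici 0)
  dreg_spec : ∀ s : ℝ, 0 ≤ s → ∀ s' : ℝ, 0 ≤ s' → M.reg s + M.dreg s * (s' - s) ≤ M.reg s'

/-- On the set of weight vectors with `‖θ‖ ≤ Cθ`, the losses up to the horizon lie in `[-1, 1]` and
their (sub)gradients are bounded by `L`. -/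
def BoundedLoss (D T : ℕ) (L Cθ : ℝ) : Prop :=
  ∀ t < T, ∀ (v : Fin D → EuclideanSpace ℝ (Fin d)) (θ : FeatureSpace D), ‖θ‖ ≤ Cθ →
    M.rfLoss v t θ ∈ Set.Icc (-1 : ℝ) 1 ∧ ‖M.rfGrad v t θ‖ ≤ L

end Task

/-- Shift-invariant, standardized kernel on `ℝ^d`, bounded above by `1`. -/
structure StandardKernel {d : ℕ}
    (κ : EuclideanSpace ℝ (Fin d) → EuclideanSpace ℝ (Fin d) → ℝ) : Prop where
  shift : ∀ x x' u, κ (x + u) (x' + u) = κ x x'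
  standardized : ∀ x, κ x x = 1
  bounded : ∀ x x', κ x x' ≤ 1

/-- `π` is the spectral distribution of `κ`: `κ(x, x') = 𝔼_{v ∼ π} exp(j vᵀ(x - x'))`. (A
probability measure is determined by this identity.) -/
def IsSpectral {d : ℕ} (κ : EuclideanSpace ℝ (Fin d) → EuclideanSpace ℝ (Fin d) → ℝ)
    (π : Measure (EuclideanSpace ℝ (Fin d))) : Prop :=
  IsProbabilityMeasure π ∧ ∀ x x', charFun π (x - x') = (κ x x' : ℂ)

/-- The second moment `σ² = 𝔼_{v ∼ π} ‖v‖²`, possibly infinite. -/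
def sigmaSq {d : ℕ} (π : Measure (EuclideanSpace ℝ (Fin d))) : ℝ≥0∞ :=
  ∫⁻ v, ‖v‖ₑ ^ 2 ∂π

/-- The failure probability `2^8 (σ/ε)² exp(-D ε² / (4d + 8))`. -/
def failProb {d : ℕ} (π : Measure (EuclideanSpace ℝ (Fin d))) (D : ℕ) (ε : ℝ) : ℝ≥0∞ :=
  2 ^ 8 * (sigmaSq π / ENNReal.ofReal (ε ^ 2)) *
    ENNReal.ofReal (Real.exp (-(D * ε ^ 2) / (4 * d + 8)))

/-- The regret bound
`ln P / η + (1 + ε) C² / (2η) + η L² T / 2 + η T + ε L T C`. -/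
def regretBound (P T : ℕ) (L C η ε : ℝ) : ℝ :=
  Real.log P / η + (1 + ε) * C ^ 2 / (2 * η) + η * L ^ 2 * T / 2 + η * T + ε * L * T * C

end Raker

end

/-!
The regret splits into three contributions. By Jensen's inequality the loss of the combined
function is at most the weighted average of the losses of the single-kernel functions
(`Task.rakerLoss_le`). Exponential weights make this average competitive with each single kernel
`p`, at the price `log P / η + η T` (`Task.hedge_regret`), and online gradient descent makes the
iterates of kernel `p` competitive with each fixed weight vector `θ`, at the price
`‖θ‖² / (2 η) + η L² T / 2` (`Task.theta_regret`). The comparator is `θ = ∑ α_t z(x_t)`, the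
best function in hindsight with the kernel functions replaced by the random features. It has norm
at most `C`, and if the features reproduce the kernel up to `ε` on all pairs of inputs, then it
loses at most `ε L C` per slot against the kernel expansion (`Task.rfLoss_comparator_le`). There the
predictions and the regularizer must be treated together, because `L` only bounds their joint slope.

It remains to bound the probability that the features fail to reproduce the kernel up to `ε`. The
error at a pair of inputs with difference `δ` is the centred average of `cos (v_jᵀ δ)`, and
`‖δ‖ ≤ 2`. Hoeffding's inequality at the points of an `r`-net, the cardinality of which is bounded
by comparing volumes, and Chebyshev's inequality for the Lipschitz constant give a bound
for all `δ` at once (`measureReal_exists_deviation_le`). This alone does not give a bound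
proportional to `σ²` when `σ` is small compared with `ε`. The missing factor comes from
`measure_exists_deviation_le_mul`: a large deviation requires `2 ∑ ‖v_i‖² ≥ D ε` (unless
`2 σ² ≥ ε`), and after deletion of the `i`-th frequency the deviation is independent of `v_i`, so
that the two bounds multiply. This holds for every `σ` and leaves enough room in the constants to
reach `2⁸ (σ / ε)² exp (-D ε² / (4 d + 8))` (`measure_exists_deviation_le_failProb`).
-/

/-! ### Random features -/

namespace Raker

theorem inner_features {d D : ℕ} (v : Fin D → EuclideanSpace ℝ (Fin d))
    (x x' : EuclideanSpace ℝ (Fin d)) :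
    ⟪features v x, features v x'⟫_ℝ = (D : ℝ)⁻¹ * ∑ i, Real.cos ⟪v i, x - x'⟫_ℝ := by
  have h : (Real.sqrt D)⁻¹ * (Real.sqrt D)⁻¹ = (D : ℝ)⁻¹ := by
    rw [← mul_inv, Real.mul_self_sqrt (Nat.cast_nonneg D)]
  rw [PiLp.inner_apply, Fintype.sum_sum_type, ← Finset.sum_add_distrib, Finset.mul_sum]
  refine Finset.sum_congr rfl fun i _ => ?_
  simp only [features, Sum.elim_inl, Sum.elim_inr, inner_sub_right, Real.cos_sub, ← h,
    RCLike.inner_apply, conj_trivial]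
  ring

theorem norm_features {d D : ℕ} (hD : 0 < D) (v : Fin D → EuclideanSpace ℝ (Fin d))
    (x : EuclideanSpace ℝ (Fin d)) : ‖features v x‖ = 1 := by
  have hD' : (D : ℝ) ≠ 0 := by positivity
  have h : ‖features v x‖ ^ 2 = 1 := by
    rw [← real_inner_self_eq_norm_sq, inner_features]
    simp [hD']
  nlinarith [norm_nonneg (features v x)]

/-! ### Online gradient descent -/

namespace Task

variable {d : ℕ} {M : Task d} {T : ℕ}

theorem ConvexLoss.dcost_mono (hM : M.ConvexLoss T) {t : ℕ} (ht : t < T) {u u' : ℝ}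
    (h : u ≤ u') : M.dcost u (M.y t) ≤ M.dcost u' (M.y t) := by
  rcases h.eq_or_lt with rfl | h
  · exact le_rfl
  have h1 := hM.dcost_spec t ht u u'
  have h2 := hM.dcost_spec t ht u' u
  nlinarith

theorem ConvexLoss.dreg_mono (hM : M.ConvexLoss T) {s s' : ℝ} (hs : 0 ≤ s)
    (h : s ≤ s') : M.dreg s ≤ M.dreg s' := by
  rcases h.eq_or_lt with rfl | h
  · exact le_rfl
  have h1 := hM.dreg_spec s hs s' (hs.trans h.le)
  have h2 := hM.dreg_spec s' (hs.trans h.le) s hs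
  nlinarith

/-- At `0` a subderivative of the regularizer may be negative, since there is no constraint from
the left. -/
theorem ConvexLoss.dreg_nonneg (hM : M.ConvexLoss T) {s : ℝ} (hs : 0 < s) : 0 ≤ M.dreg s := by
  have h1 := hM.dreg_spec s hs.le 0 le_rfl
  have h2 := hM.reg_mono (Set.mem_Ici.2 le_rfl) (Set.mem_Ici.2 hs.le) hs.le
  nlinarith

theorem ConvexLoss.rfLoss_add_inner_rfGrad_le (hM : M.ConvexLoss T) {D t : ℕ} (ht : t < T)
    (v : Fin D → EuclideanSpace ℝ (Fin d)) (θ θ' : FeatureSpace D) :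
    M.rfLoss v t θ + ⟪M.rfGrad v t θ, θ' - θ⟫_ℝ ≤ M.rfLoss v t θ' := by
  have h1 := hM.dcost_spec t ht ⟪θ, features v (M.x t)⟫_ℝ ⟪θ', features v (M.x t)⟫_ℝ
  have h2 : M.reg (‖θ‖ ^ 2) + 2 * M.dreg (‖θ‖ ^ 2) * ⟪θ, θ' - θ⟫_ℝ ≤ M.reg (‖θ'‖ ^ 2) := by
    rcases eq_or_ne θ 0 with rfl | h0
    · simpa using hM.reg_mono (Set.mem_Ici.2 le_rfl) (Set.mem_Ici.2 (sq_nonneg ‖θ'‖))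
        (sq_nonneg ‖θ'‖)
    · have h3 := hM.dreg_spec (‖θ‖ ^ 2) (sq_nonneg _) (‖θ'‖ ^ 2) (sq_nonneg _)
      have h4 : 0 ≤ M.dreg (‖θ‖ ^ 2) := hM.dreg_nonneg (by positivity)
      have h5 : ‖θ'‖ ^ 2 = ‖θ‖ ^ 2 + 2 * ⟪θ, θ' - θ⟫_ℝ + ‖θ' - θ‖ ^ 2 := by
        rw [← norm_add_sq_real, add_sub_cancel]
      nlinarith [mul_nonneg h4 (sq_nonneg ‖θ' - θ‖)]
  have h3 := mul_le_mul_of_nonneg_left h2 hM.lam_nonneg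
  have h4 : ⟪M.rfGrad v t θ, θ' - θ⟫_ℝ = M.dcost ⟪θ, features v (M.x t)⟫_ℝ (M.y t) *
      (⟪θ', features v (M.x t)⟫_ℝ - ⟪θ, features v (M.x t)⟫_ℝ) +
      2 * M.lam * M.dreg (‖θ‖ ^ 2) * ⟪θ, θ' - θ⟫_ℝ := by
    rw [rfGrad, inner_add_left, real_inner_smul_left, real_inner_smul_left,
      real_inner_comm _ (features v (M.x t)), inner_sub_left]
  rw [h4, rfLoss, rfLoss]
  linarith

/-- The regret of online gradient descent, multiplied by `2η`: the potential is the squared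
distance of the iterate to the comparator. -/
theorem theta_regret_aux (hM : M.ConvexLoss T) {D : ℕ} {L η : ℝ} (hη : 0 < η)
    (v : Fin D → EuclideanSpace ℝ (Fin d))
    (hL : ∀ t < T, ‖M.rfGrad v t (M.theta v η t)‖ ≤ L) (θ : FeatureSpace D) {n : ℕ} (hn : n ≤ T) :
    2 * η * ∑ t ∈ range n, (M.rfLoss v t (M.theta v η t) - M.rfLoss v t θ) +
      ‖M.theta v η n - θ‖ ^ 2 ≤ ‖θ‖ ^ 2 + n * (η ^ 2 * L ^ 2) := by
  induction n with
  | zero => simp [theta]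
  | succ n ih =>
    have ih := ih (Nat.le_of_succ_le hn)
    have h1 := hM.rfLoss_add_inner_rfGrad_le (Nat.lt_of_succ_le hn) v (M.theta v η n) θ
    have h2 : ‖M.theta v η (n + 1) - θ‖ ^ 2 = ‖M.theta v η n - θ‖ ^ 2 +
        2 * η * ⟪M.rfGrad v n (M.theta v η n), θ - M.theta v η n⟫_ℝ +
        η ^ 2 * ‖M.rfGrad v n (M.theta v η n)‖ ^ 2 := by
      rw [theta, sub_right_comm, norm_sub_sq_real, norm_smul, mul_pow, real_inner_smul_right,
        real_inner_comm, ← neg_sub θ, inner_neg_right, Real.norm_eq_abs, sq_abs]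
      ring
    have h3 : ‖M.rfGrad v n (M.theta v η n)‖ ^ 2 ≤ L ^ 2 :=
      pow_le_pow_left₀ (norm_nonneg _) (hL n (Nat.lt_of_succ_le hn)) 2
    rw [sum_range_succ, h2]
    push_cast
    nlinarith [mul_le_mul_of_nonneg_left h3 (sq_nonneg η),
      mul_le_mul_of_nonneg_left h1 hη.le]

theorem theta_regret (hM : M.ConvexLoss T) {D : ℕ} {L η : ℝ} (hη : 0 < η)
    (v : Fin D → EuclideanSpace ℝ (Fin d))
    (hL : ∀ t < T, ‖M.rfGrad v t (M.theta v η t)‖ ≤ L) (θ : FeatureSpace D) :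
    ∑ t ∈ range T, M.rfLoss v t (M.theta v η t) ≤
      ∑ t ∈ range T, M.rfLoss v t θ + ‖θ‖ ^ 2 / (2 * η) + η * L ^ 2 * T / 2 := by
  have h := theta_regret_aux hM hη v hL θ le_rfl
  rw [sum_sub_distrib] at h
  have h2 : ‖θ‖ ^ 2 / (2 * η) + η * L ^ 2 * T / 2 =
      (‖θ‖ ^ 2 + T * (η ^ 2 * L ^ 2)) / (2 * η) := by
    field_simp
  rw [add_assoc, h2, ← sub_le_iff_le_add', le_div_iff₀ (by positivity)]
  nlinarith [sq_nonneg ‖M.theta v η T - θ‖]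

/-! ### Exponential weights -/

variable {P D : ℕ} (v : Fin P → Fin D → EuclideanSpace ℝ (Fin d)) (η : ℝ)

theorem weight_pos (t : ℕ) (p : Fin P) : 0 < M.weight v η t p := by
  have hP : 0 < P := p.pos
  induction t with
  | zero => simp only [weight]; positivity
  | succ t ih => simp only [weight]; positivity

theorem sum_weight_pos [NeZero P] (t : ℕ) : 0 < ∑ q, M.weight v η t q :=
  sum_pos (fun q _ => weight_pos v η t q) univ_nonempty

theorem nweight_nonneg (t : ℕ) (p : Fin P) : 0 ≤ M.nweight v η t p :=
  div_nonneg (weight_pos v η t p).le (sum_nonneg fun q _ => (weight_pos v η t q).le)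

theorem sum_nweight [NeZero P] (t : ℕ) : ∑ p, M.nweight v η t p = 1 := by
  simp_rw [nweight, ← sum_div]
  exact div_self (sum_weight_pos v η t).ne'

/-- Jensen's inequality for the cost and for the regularizer. The latter is applied to
`∑ w̄² ‖θ‖²`, which is at most `∑ w̄ ‖θ‖²`. -/
theorem rakerLoss_le [NeZero P] (hM : M.ConvexLoss T) {t : ℕ} (ht : t < T) :
    M.rakerLoss v η t ≤ ∑ p, M.nweight v η t p * M.rfLoss (v p) t (M.theta (v p) η t) := by
  have h0 := nweight_nonneg (M := M) v η t
  have h1 := sum_nweight (M := M) v η t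
  have hcost := (hM.cost_convex t ht).map_sum_le (t := univ) (w := M.nweight v η t)
    (p := fun p => ⟪M.theta (v p) η t, features (v p) (M.x t)⟫_ℝ)
    (fun p _ => h0 p) h1 (fun _ _ => Set.mem_univ _)
  have hreg := hM.reg_convex.map_sum_le (t := univ) (w := M.nweight v η t)
    (p := fun p => ‖M.theta (v p) η t‖ ^ 2)
    (fun p _ => h0 p) h1 (fun _ _ => Set.mem_Ici.2 (sq_nonneg _))
  simp only [smul_eq_mul] at hcost hreg
  have hle : ∑ p, ‖M.nweight v η t p • M.theta (v p) η t‖ ^ 2 ≤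
      ∑ p, M.nweight v η t p * ‖M.theta (v p) η t‖ ^ 2 := by
    refine sum_le_sum fun p _ => ?_
    have h2 : M.nweight v η t p ≤ 1 := h1 ▸ single_le_sum (fun q _ => h0 q) (mem_univ p)
    rw [norm_smul, mul_pow, Real.norm_eq_abs, sq_abs]
    exact mul_le_mul_of_nonneg_right (by nlinarith [h0 p]) (sq_nonneg _)
  have hmono := hM.reg_mono (Set.mem_Ici.2 (sum_nonneg fun p _ => sq_nonneg _))
    (Set.mem_Ici.2 (sum_nonneg fun p _ => mul_nonneg (h0 p) (sq_nonneg _))) hle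
  have := mul_le_mul_of_nonneg_left (hmono.trans hreg) hM.lam_nonneg
  simp only [rakerLoss, rfLoss, mul_add, sum_add_distrib]
  refine add_le_add hcost (this.trans_eq ?_)
  rw [mul_sum]
  exact sum_congr rfl fun p _ => by ring

end Task

/-- The chord of `exp` over `[-η, η]` lies above the graph. -/
theorem exp_mul_le_cosh_add (η : ℝ) {x : ℝ} (hx : x ∈ Set.Icc (-1 : ℝ) 1) :
    Real.exp (η * x) ≤ Real.cosh η + x * Real.sinh η := by
  have h := convexOn_exp.2 (Set.mem_univ η) (Set.mem_univ (-η))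
    (by linarith [hx.1] : 0 ≤ (1 + x) / 2) (by linarith [hx.2] : 0 ≤ (1 - x) / 2) (by ring)
  simp only [smul_eq_mul] at h
  rw [show (1 + x) / 2 * η + (1 - x) / 2 * -η = η * x by ring] at h
  rw [Real.cosh_eq, Real.sinh_eq]
  linarith

/-- A form of Hoeffding's lemma for a finitely supported distribution `w` on `[-1, 1]` with mean
`m`. By Jensen, `exp (η m)` is at most the average of `exp (η ℓ)`; the product of the averages of
`exp (-η ℓ)` and `exp (η ℓ)` is at most `cosh² η - m² sinh² η`. -/
theorem sum_mul_exp_le {ι : Type*} [Fintype ι] {w ℓ : ι → ℝ} (hw : ∀ i, 0 ≤ w i)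
    (hw1 : ∑ i, w i = 1) (hℓ : ∀ i, ℓ i ∈ Set.Icc (-1 : ℝ) 1) (η : ℝ) :
    ∑ i, w i * Real.exp (-η * ℓ i) ≤ Real.exp (-η * ∑ i, w i * ℓ i + η ^ 2) := by
  set m := ∑ i, w i * ℓ i with hm
  have hchord : ∀ η : ℝ, ∑ i, w i * Real.exp (η * ℓ i) ≤ Real.cosh η + m * Real.sinh η := by
    intro η
    calc ∑ i, w i * Real.exp (η * ℓ i) ≤ ∑ i, w i * (Real.cosh η + ℓ i * Real.sinh η) :=
          sum_le_sum fun i _ => mul_le_mul_of_nonneg_left (exp_mul_le_cosh_add η (hℓ i)) (hw i)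
      _ = Real.cosh η + m * Real.sinh η := by
          simp only [mul_add, sum_add_distrib, ← mul_assoc, ← sum_mul, hw1, one_mul, hm]
  have hjensen : Real.exp (η * m) ≤ ∑ i, w i * Real.exp (η * ℓ i) := by
    have h := convexOn_exp.map_sum_le (t := univ) (w := w) (p := fun i => η * ℓ i)
      (fun i _ => hw i) hw1 (fun _ _ => Set.mem_univ _)
    simp only [smul_eq_mul] at h
    refine le_trans (le_of_eq ?_) h
    rw [hm, mul_sum]
    exact congrArg _ (sum_congr rfl fun i _ => by ring)
  have h1 := hchord (-η)
  rw [Real.cosh_neg, Real.sinh_neg] at h1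
  have h0 : 0 ≤ ∑ i, w i * Real.exp (-η * ℓ i) :=
    sum_nonneg fun i _ => mul_nonneg (hw i) (Real.exp_pos _).le
  have h2 : (∑ i, w i * Real.exp (-η * ℓ i)) * Real.exp (η * m) ≤ Real.exp (η ^ 2) := by
    calc (∑ i, w i * Real.exp (-η * ℓ i)) * Real.exp (η * m)
        ≤ (Real.cosh η + m * -Real.sinh η) * (Real.cosh η + m * Real.sinh η) :=
          mul_le_mul h1 (hjensen.trans (hchord η)) (Real.exp_pos _).le (h0.trans h1)
      _ ≤ Real.cosh η * Real.cosh η := by nlinarith [sq_nonneg (m * Real.sinh η)]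
      _ ≤ Real.exp (η ^ 2 / 2) * Real.exp (η ^ 2 / 2) :=
          mul_self_le_mul_self (Real.cosh_pos η).le (Real.cosh_le_exp_half_sq η)
      _ = Real.exp (η ^ 2) := by rw [← Real.exp_add]; congr 1; ring
  rw [neg_mul, add_comm, ← sub_eq_add_neg, Real.exp_sub, le_div_iff₀ (Real.exp_pos _)]
  exact h2

namespace Task

variable {d : ℕ} {M : Task d} {T P D : ℕ} (v : Fin P → Fin D → EuclideanSpace ℝ (Fin d)) (η : ℝ)

theorem weight_eq (n : ℕ) (p : Fin P) : M.weight v η n p =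
    (1 / P) * Real.exp (-η * ∑ t ∈ range n, M.rfLoss (v p) t (M.theta (v p) η t)) := by
  induction n with
  | zero => simp [weight]
  | succ n ih => rw [weight, ih, mul_assoc, ← Real.exp_add, sum_range_succ, ← mul_add]

theorem sum_weight_le [NeZero P]
    (hb : ∀ t < T, ∀ p, M.rfLoss (v p) t (M.theta (v p) η t) ∈ Set.Icc (-1 : ℝ) 1)
    {n : ℕ} (hn : n ≤ T) : ∑ p, M.weight v η n p ≤ Real.exp (-η * (∑ t ∈ range n,
      ∑ p, M.nweight v η t p * M.rfLoss (v p) t (M.theta (v p) η t)) + n * η ^ 2) := by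
  induction n with
  | zero =>
    have : (P : ℝ) ≠ 0 := NeZero.ne _
    simp [weight, this]
  | succ n ih =>
    have ih := ih (Nat.le_of_succ_le hn)
    have h := sum_mul_exp_le (nweight_nonneg (M := M) v η n) (sum_nweight v η n)
      (hb n (Nat.lt_of_succ_le hn)) η
    have h1 : ∑ p, M.weight v η (n + 1) p = (∑ p, M.weight v η n p) *
        ∑ p, M.nweight v η n p * Real.exp (-η * M.rfLoss (v p) n (M.theta (v p) η n)) := by
      rw [mul_sum]
      refine sum_congr rfl fun p _ => ?_
      rw [weight, nweight, ← mul_assoc, mul_div_cancel₀ _ (sum_weight_pos v η n).ne']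
    rw [h1]
    refine (mul_le_mul ih h (sum_nonneg fun p _ => mul_nonneg (nweight_nonneg v η n p)
      (Real.exp_pos _).le) (Real.exp_pos _).le).trans_eq ?_
    rw [← Real.exp_add, sum_range_succ]
    congr 1
    push_cast
    ring

theorem hedge_regret [NeZero P] (hη : 0 < η)
    (hb : ∀ t < T, ∀ p, M.rfLoss (v p) t (M.theta (v p) η t) ∈ Set.Icc (-1 : ℝ) 1) (p : Fin P) :
    ∑ t ∈ range T, ∑ q, M.nweight v η t q * M.rfLoss (v q) t (M.theta (v q) η t) ≤
      ∑ t ∈ range T, M.rfLoss (v p) t (M.theta (v p) η t) + Real.log P / η + η * T := by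
  have hP : (0 : ℝ) < P := Nat.cast_pos.2 p.pos
  have h1 := (single_le_sum (fun q _ => (weight_pos (M := M) v η T q).le) (mem_univ p)).trans
    (sum_weight_le v η hb le_rfl)
  rw [weight_eq, one_div, ← Real.exp_log (inv_pos.2 hP), ← Real.exp_add, Real.exp_le_exp,
    Real.log_inv] at h1
  rw [add_assoc, ← sub_le_iff_le_add', ← mul_le_mul_iff_right₀ hη]
  have h2 : η * (Real.log P / η + η * T) = Real.log P + T * η ^ 2 := by field_simp
  rw [h2]
  linarith

/-! ### The comparator in the random-feature space -/

theorem norm_sum_smul_features_le (hD : 0 < D) (v : Fin D → EuclideanSpace ℝ (Fin d))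
    (α : ℕ → ℝ) :
    ‖∑ s ∈ range T, α s • features v (M.x s)‖ ≤ ∑ s ∈ range T, |α s| :=
  norm_sum_le_of_le _ fun s _ => by
    rw [norm_smul, norm_features hD, mul_one, Real.norm_eq_abs]

/-- The gradient bound at the two weight vectors `±c z(x_t)` bounds the slope of the cost at all
predictions in `[-c, c]` together with the slope of the regularizer at norm `c`; monotonicity of
the subderivatives rules out a cancellation. -/
theorem abs_dcost_add_le (hM : M.ConvexLoss T) (hD : 0 < D) {L Cθ c u : ℝ}
    (hB : M.BoundedLoss D T L Cθ) {t : ℕ} (ht : t < T) (hc : c ≤ Cθ) (hu : |u| ≤ c) :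
    |M.dcost u (M.y t)| + 2 * M.lam * M.dreg (c ^ 2) * c ≤ L := by
  have hc0 : 0 ≤ c := (abs_nonneg u).trans hu
  have key : ∀ c' : ℝ, |c'| ≤ c →
      |M.dcost c' (M.y t) + 2 * M.lam * M.dreg (c' ^ 2) * c'| ≤ L := by
    intro c' hc'
    let z := features (fun _ : Fin D => (0 : EuclideanSpace ℝ (Fin d))) (M.x t)
    have hz : ‖z‖ = 1 := norm_features hD _ _
    have h := (hB t ht (fun _ => 0) (c' • z) (by
      rw [norm_smul, hz, mul_one, Real.norm_eq_abs]; exact hc'.trans hc)).2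
    have h2 : M.rfGrad (fun _ => 0) t (c' • z) =
        (M.dcost c' (M.y t) + 2 * M.lam * M.dreg (c' ^ 2) * c') • z := by
      have h3 : ⟪c' • z, z⟫_ℝ = c' := by
        rw [real_inner_smul_left, real_inner_self_eq_norm_sq, hz]; ring
      have h4 : ‖c' • z‖ ^ 2 = c' ^ 2 := by
        rw [norm_smul, hz, mul_one, Real.norm_eq_abs, sq_abs]
      rw [rfGrad, h3, h4, smul_smul, ← add_smul]
    rwa [h2, norm_smul, hz, mul_one, Real.norm_eq_abs] at h
  have hu' := abs_le.1 hu
  rcases le_total 0 (M.dcost u (M.y t)) with h | h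
  · have h1 := (abs_le.1 (key c (abs_of_nonneg hc0).le)).2
    rw [abs_of_nonneg h]
    linarith [hM.dcost_mono ht hu'.2]
  · have h1 := (abs_le.1 (key (-c) (by rw [abs_neg, abs_of_nonneg hc0]))).1
    rw [abs_of_nonpos h]
    rw [neg_sq] at h1
    linarith [hM.dcost_mono ht hu'.1]

/-- If the random features reproduce a kernel up to `ε` on the inputs, then transplanting a kernel
expansion to the random features raises the loss by at most `ε L C`. The prediction moves by at most
`ε ∑ |α|` and the squared norm by at most `ε (∑ |α|)²`. -/
theorem rfLoss_comparator_le (hM : M.ConvexLoss T) (hD : 0 < D) {L Cθ C ε : ℝ}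
    (hB : M.BoundedLoss D T L Cθ) (hε : 0 ≤ ε) (v : Fin D → EuclideanSpace ℝ (Fin d))
    {α : ℕ → ℝ} (hα : ∑ s ∈ range T, |α s| ≤ C) (hC : C ≤ Cθ) {K : ℕ → ℕ → ℝ}
    (hK : ∀ s < T, ∀ t < T, |⟪features v (M.x s), features v (M.x t)⟫_ℝ - K s t| ≤ ε)
    (hK0 : 0 ≤ ∑ s ∈ range T, ∑ r ∈ range T, α s * α r * K s r) {t : ℕ} (ht : t < T) :
    M.rfLoss v t (∑ s ∈ range T, α s • features v (M.x s)) ≤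
      M.cost (∑ s ∈ range T, α s * K s t) (M.y t) +
        M.lam * M.reg (∑ s ∈ range T, ∑ r ∈ range T, α s * α r * K s r) + ε * L * C := by
  set θ := ∑ s ∈ range T, α s • features v (M.x s) with hθ
  set A := ∑ s ∈ range T, |α s| with hA
  set n := ∑ s ∈ range T, ∑ r ∈ range T, α s * α r * K s r with hn
  set u := ⟪θ, features v (M.x t)⟫_ℝ with hu
  have hA0 : 0 ≤ A := sum_nonneg fun _ _ => abs_nonneg _
  have hθA : ‖θ‖ ≤ A := norm_sum_smul_features_le hD v α
  have huA : |u| ≤ A := by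
    have := abs_real_inner_le_norm θ (features v (M.x t))
    rw [norm_features hD, mul_one] at this
    exact this.trans hθA
  have hL : 0 ≤ L := (norm_nonneg _).trans (hB t ht v 0 (by
    rw [norm_zero]; exact hA0.trans (hα.trans hC))).2
  have hslope := abs_dcost_add_le hM hD hB ht (hα.trans hC) huA
  -- the change of the prediction
  have h1 : |u - ∑ s ∈ range T, α s * K s t| ≤ ε * A := by
    rw [hu, hθ, sum_inner, ← sum_sub_distrib, hA, mul_sum]
    refine (abs_sum_le_sum_abs _ _).trans (sum_le_sum fun s hs => ?_)
    rw [real_inner_smul_left, ← mul_sub, abs_mul, mul_comm]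
    exact mul_le_mul_of_nonneg_right (hK s (mem_range.1 hs) t ht) (abs_nonneg _)
  -- the change of the squared norm
  have h2 : ‖θ‖ ^ 2 - n ≤ ε * A ^ 2 := by
    have h3 : ‖θ‖ ^ 2 - n = ∑ s ∈ range T, ∑ r ∈ range T, α s * α r *
        (⟪features v (M.x s), features v (M.x r)⟫_ℝ - K s r) := by
      rw [← real_inner_self_eq_norm_sq, hθ, sum_inner, hn, ← sum_sub_distrib]
      refine sum_congr rfl fun s _ => ?_
      rw [inner_sum, ← sum_sub_distrib]
      refine sum_congr rfl fun r _ => ?_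
      rw [real_inner_smul_left, real_inner_smul_right]
      ring
    have h4 : ε * A ^ 2 = ∑ s ∈ range T, ∑ r ∈ range T, |α s| * |α r| * ε := by
      rw [sq, hA, sum_mul_sum, mul_sum]
      refine sum_congr rfl fun s _ => ?_
      rw [mul_sum]
      exact sum_congr rfl fun r _ => mul_comm _ _
    rw [h3, h4]
    refine sum_le_sum fun s hs => sum_le_sum fun r hr => (le_abs_self _).trans ?_
    rw [abs_mul, abs_mul]
    exact mul_le_mul_of_nonneg_left (hK s (mem_range.1 hs) r (mem_range.1 hr)) (by positivity)
  have hcost : M.cost u (M.y t) - M.cost (∑ s ∈ range T, α s * K s t) (M.y t) ≤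
      |M.dcost u (M.y t)| * (ε * A) := by
    have h3 := hM.dcost_spec t ht u (∑ s ∈ range T, α s * K s t)
    have h4 : M.dcost u (M.y t) * (u - ∑ s ∈ range T, α s * K s t) ≤
        |M.dcost u (M.y t)| * (ε * A) :=
      (le_abs_self _).trans (by rw [abs_mul]; gcongr)
    linarith
  have hreg : M.reg (‖θ‖ ^ 2) - M.reg n ≤ M.dreg (A ^ 2) * A * (ε * A) ∧
      0 ≤ M.dreg (A ^ 2) * A := by
    rcases hA0.eq_or_lt with h0 | h0
    · have hθ0 : ‖θ‖ = 0 := le_antisymm (h0 ▸ hθA) (norm_nonneg _)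
      have := hM.reg_mono (Set.mem_Ici.2 le_rfl) (Set.mem_Ici.2 hK0) hK0
      rw [hθ0, ← h0]
      simpa using this
    have hd : 0 ≤ M.dreg (A ^ 2) := hM.dreg_nonneg (by positivity)
    refine ⟨?_, by positivity⟩
    rcases le_total (‖θ‖ ^ 2) n with h | h
    · have := hM.reg_mono (Set.mem_Ici.2 (sq_nonneg ‖θ‖)) (Set.mem_Ici.2 hK0) h
      have : 0 ≤ M.dreg (A ^ 2) * A * (ε * A) := by positivity
      linarith
    · have h3 := hM.dreg_spec (‖θ‖ ^ 2) (sq_nonneg _) n hK0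
      have h4 := hM.dreg_mono (sq_nonneg ‖θ‖) (pow_le_pow_left₀ (norm_nonneg θ) hθA 2)
      nlinarith [mul_le_mul_of_nonneg_right h4 (sub_nonneg.2 h),
        mul_le_mul_of_nonneg_left h2 hd]
  have h5 := mul_le_mul_of_nonneg_left hreg.1 hM.lam_nonneg
  have h6 : ε * A * L ≤ ε * L * C := by
    rw [mul_right_comm]; gcongr
  have h7 := mul_le_mul_of_nonneg_left hslope (mul_nonneg hε hA0)
  have h8 : 0 ≤ M.lam * (M.dreg (A ^ 2) * A) * (ε * A) :=
    mul_nonneg (mul_nonneg hM.lam_nonneg hreg.2) (mul_nonneg hε hA0)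
  rw [rfLoss]
  nlinarith

/-- The regret bound for a fixed realization of the random features which reproduces the kernel
up to `ε` on the inputs. -/
theorem rakerTotal_sub_rkhsTotal_le (hM : M.ConvexLoss T) (hD : 0 < D) {L Cθ C ε η : ℝ}
    (hB : M.BoundedLoss D T L Cθ) (hε : 0 ≤ ε) (hη : 0 < η)
    (v : Fin P → Fin D → EuclideanSpace ℝ (Fin d))
    (hθ : ∀ p, ∀ t < T, ‖M.theta (v p) η t‖ ≤ Cθ) (p : Fin P)
    {κ : EuclideanSpace ℝ (Fin d) → EuclideanSpace ℝ (Fin d) → ℝ}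
    {H : Type*} [NormedAddCommGroup H] [InnerProductSpace ℝ H] [CompleteSpace H]
    [RKHS ℝ H (EuclideanSpace ℝ (Fin d)) ℝ] (hκ : ∀ x x', RKHS.kernel H x x' 1 = κ x x')
    {f : H} {α : ℕ → ℝ} (hf : f = ∑ t ∈ range T, α t • RKHS.kerFun H (M.x t) (1 : ℝ))
    (hα : ∑ s ∈ range T, |α s| ≤ C) (hC : C ≤ Cθ)
    (hK : ∀ s < T, ∀ t < T, |⟪features (v p) (M.x s), features (v p) (M.x t)⟫_ℝ -
      κ (M.x t) (M.x s)| ≤ ε) :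
    M.rakerTotal v η T - M.rkhsTotal T f ≤ regretBound P T L C η ε := by
  have : NeZero P := ⟨p.pos.ne'⟩
  have hnorm : ‖f‖ ^ 2 =
      ∑ s ∈ range T, ∑ r ∈ range T, α s * α r * κ (M.x r) (M.x s) := by
    conv_lhs => rw [← real_inner_self_eq_norm_sq, hf, sum_inner]
    refine sum_congr rfl fun s _ => ?_
    rw [inner_sum]
    refine sum_congr rfl fun r _ => ?_
    rw [real_inner_smul_left, real_inner_smul_right, RKHS.inner_kerFun, RKHS.kerFun_apply, hκ]
    simp [mul_assoc]
  have heval : ∀ t, f (M.x t) = ∑ s ∈ range T, α s * κ (M.x t) (M.x s) := by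
    intro t
    have h1 : f (M.x t) = ⟪f, RKHS.kerFun H (M.x t) (1 : ℝ)⟫_ℝ := by simp
    rw [h1, hf, sum_inner]
    refine sum_congr rfl fun s _ => ?_
    rw [real_inner_smul_left, RKHS.inner_kerFun, RKHS.kerFun_apply, hκ]
    simp
  set θ := ∑ s ∈ range T, α s • features (v p) (M.x s) with hθdef
  have hA0 : 0 ≤ ∑ s ∈ range T, |α s| := sum_nonneg fun _ _ => abs_nonneg _
  have h1 : M.rakerTotal v η T ≤
      ∑ t ∈ range T, ∑ q, M.nweight v η t q * M.rfLoss (v q) t (M.theta (v q) η t) :=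
    sum_le_sum fun t ht => rakerLoss_le v η hM (mem_range.1 ht)
  have h2 := hedge_regret v η hη (fun t ht q => (hB t ht (v q) _ (hθ q t ht)).1) p
  have h3 := theta_regret hM hη (v p) (fun t ht => (hB t ht (v p) _ (hθ p t ht)).2) θ
  have h4 : ∑ t ∈ range T, M.rfLoss (v p) t θ ≤ M.rkhsTotal T f + ε * L * T * C := by
    have h5 : M.rkhsTotal T f + ε * L * T * C = ∑ t ∈ range T,
        (M.cost (f (M.x t)) (M.y t) + M.lam * M.reg (‖f‖ ^ 2) + ε * L * C) := by
      rw [sum_add_distrib, sum_const, card_range, nsmul_eq_mul, rkhsTotal]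
      ring
    rw [h5]
    refine sum_le_sum fun t ht => ?_
    rw [heval, hnorm]
    exact rfLoss_comparator_le hM hD hB hε (v p) hα hC (K := fun s t => κ (M.x t) (M.x s))
      hK (hnorm ▸ sq_nonneg _) (mem_range.1 ht)
  have h5 : ‖θ‖ ^ 2 / (2 * η) ≤ (1 + ε) * C ^ 2 / (2 * η) := by
    have h6 : ‖θ‖ ^ 2 ≤ C ^ 2 :=
      pow_le_pow_left₀ (norm_nonneg _) ((norm_sum_smul_features_le hD (v p) α).trans hα) 2
    gcongr
    nlinarith [mul_nonneg hε (sq_nonneg C)]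
  rw [regretBound]
  linarith

end Task

end Raker

/-! ### Nets of Euclidean balls -/

namespace Raker

/-- A volume comparison: the balls of radius `r / 2` around the points of an `r`-separated set are
disjoint and contained in the ball of radius `R + r / 2`. -/
theorem card_le_of_separated {d : ℕ} {R r : ℝ} (hR : 0 ≤ R) (hr : 0 < r)
    (s : Finset (EuclideanSpace ℝ (Fin d))) (hs : ∀ c ∈ s, ‖c‖ ≤ R)
    (h : ∀ c ∈ s, ∀ c' ∈ s, c ≠ c' → r ≤ ‖c - c'‖) : (s.card : ℝ) ≤ (1 + 2 * R / r) ^ d := by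
  let μ : Measure (EuclideanSpace ℝ (Fin d)) := volume
  have hδ : 0 < r / 2 := by positivity
  have hρ : 0 < R + r / 2 := by positivity
  have hdisj : Set.Pairwise (s : Set (EuclideanSpace ℝ (Fin d)))
      (Function.onFun Disjoint fun c => Metric.ball c (r / 2)) := by
    intro c hc c' hc' hcc
    refine Metric.ball_disjoint_ball ?_
    rw [dist_eq_norm, add_halves]
    exact h c hc c' hc' hcc
  have hsub : ⋃ c ∈ s, Metric.ball c (r / 2) ⊆ Metric.ball 0 (R + r / 2) := by
    refine Set.iUnion₂_subset fun c hc => Metric.ball_subset_ball' ?_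
    rw [dist_zero_right]
    linarith [hs c hc]
  have hvol : (s.card : ℝ≥0∞) * ENNReal.ofReal ((r / 2) ^ d) * μ (Metric.ball 0 1) ≤
      ENNReal.ofReal ((R + r / 2) ^ d) * μ (Metric.ball 0 1) := by
    have h1 := measure_mono (μ := μ) hsub
    rw [measure_biUnion_finset hdisj fun c _ => measurableSet_ball,
      μ.addHaar_ball_of_pos _ hρ] at h1
    simp only [μ.addHaar_ball_of_pos _ hδ, finrank_euclideanSpace_fin] at h1
    rwa [sum_const, nsmul_eq_mul, ← mul_assoc] at h1
  have h2 := (ENNReal.mul_le_mul_iff_left (Metric.measure_ball_pos _ _ zero_lt_one).ne'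
    measure_ball_lt_top.ne).1 hvol
  have h3 : (s.card : ℝ) * (r / 2) ^ d ≤ (R + r / 2) ^ d := by
    have := ENNReal.toReal_le_of_le_ofReal (pow_nonneg hρ.le d) h2
    rwa [ENNReal.toReal_mul, ENNReal.toReal_natCast,
      ENNReal.toReal_ofReal (pow_nonneg hδ.le d)] at this
  have h4 : 1 + 2 * R / r = (R + r / 2) / (r / 2) := by field_simp; ring
  rw [h4, div_pow, le_div_iff₀ (pow_pos hδ d)]
  exact h3

/-- A maximal `r`-separated subset of a ball is an `r`-net. -/
theorem exists_net (d : ℕ) {R r : ℝ} (hR : 0 ≤ R) (hr : 0 < r) :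
    ∃ N : Finset (EuclideanSpace ℝ (Fin d)), (N.card : ℝ) ≤ (1 + 2 * R / r) ^ d ∧
      ∀ x : EuclideanSpace ℝ (Fin d), ‖x‖ ≤ R → ∃ c ∈ N, ‖x - c‖ ≤ r := by
  classical
  let sep : Set (Finset (EuclideanSpace ℝ (Fin d))) :=
    {s | (∀ c ∈ s, ‖c‖ ≤ R) ∧ ∀ c ∈ s, ∀ c' ∈ s, c ≠ c' → r ≤ ‖c - c'‖}
  have hbdd : BddAbove (Finset.card '' sep) := by
    refine ⟨⌊(1 + 2 * R / r) ^ d⌋₊, ?_⟩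
    rintro _ ⟨s, hs, rfl⟩
    exact Nat.le_floor (card_le_of_separated hR hr s hs.1 hs.2)
  obtain ⟨N, hN, hmax⟩ := Nat.sSup_mem (s := Finset.card '' sep)
    ⟨_, ∅, by simp [sep], rfl⟩ hbdd
  refine ⟨N, card_le_of_separated hR hr N hN.1 hN.2, fun x hx => ?_⟩
  by_contra! hcon
  have hxN : x ∉ N := fun h => by
    have := hcon x h
    rw [sub_self, norm_zero] at this
    linarith
  have hmem : insert x N ∈ sep := by
    refine ⟨fun c hc => ?_, fun c hc c' hc' hcc => ?_⟩
    · rcases mem_insert.1 hc with rfl | hc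
      exacts [hx, hN.1 c hc]
    · rcases mem_insert.1 hc with rfl | h1 <;> rcases mem_insert.1 hc' with rfl | h2
      · exact absurd rfl hcc
      · exact (hcon c' h2).le
      · rw [norm_sub_rev]; exact (hcon c h1).le
      · exact hN.2 c h1 c' h2 hcc
  have h1 := le_csSup hbdd ⟨_, hmem, rfl⟩
  rw [card_insert_of_notMem hxN, ← hmax] at h1
  omega

/-! ### The second moment of the spectral distribution -/

section Deviation

variable {d : ℕ} (π : Measure (EuclideanSpace ℝ (Fin d)))

/-- The mean of `cos (vᵀ δ)` for `v ∼ π`. For a spectral distribution this is the kernel, as a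
function of the difference `δ` of the inputs. -/
noncomputable def cosMean (δ : EuclideanSpace ℝ (Fin d)) : ℝ := ∫ v, Real.cos ⟪v, δ⟫_ℝ ∂π

/-- The centred sum of the random features `cos (v_jᵀ δ)` with indices `j ∈ s`. -/
noncomputable def deviation {D : ℕ} (s : Finset (Fin D)) (v : Fin D → EuclideanSpace ℝ (Fin d))
    (δ : EuclideanSpace ℝ (Fin d)) : ℝ :=
  ∑ j ∈ s, (Real.cos ⟪v j, δ⟫_ℝ - cosMean π δ)

variable {π}

@[fun_prop]
theorem measurable_deviation {D : ℕ} (s : Finset (Fin D)) (δ : EuclideanSpace ℝ (Fin d)) :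
    Measurable fun v : Fin D → EuclideanSpace ℝ (Fin d) => deviation π s v δ := by
  unfold deviation
  fun_prop

theorem memLp_norm (hσ : sigmaSq π ≠ ⊤) :
    MemLp (fun v : EuclideanSpace ℝ (Fin d) => ‖v‖) 2 π := by
  refine ⟨by fun_prop, ?_⟩
  rw [eLpNorm_lt_top_iff_lintegral_rpow_enorm_lt_top (by norm_num) (by norm_num)]
  refine lt_of_eq_of_lt ?_ (lt_top_iff_ne_top.2 hσ)
  simp [sigmaSq]

theorem integrable_norm_sq (hσ : sigmaSq π ≠ ⊤) :
    Integrable (fun v : EuclideanSpace ℝ (Fin d) => ‖v‖ ^ 2) π :=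
  (memLp_norm hσ).integrable_sq

theorem integral_norm_sq : ∫ v, ‖v‖ ^ 2 ∂π = (sigmaSq π).toReal := by
  rw [integral_eq_lintegral_of_nonneg_ae (ae_of_all _ fun _ => sq_nonneg _) (by fun_prop), sigmaSq]
  congr 1
  refine lintegral_congr fun v => ?_
  rw [ENNReal.ofReal_pow (norm_nonneg v), ofReal_norm]

variable [IsProbabilityMeasure π]

theorem integrable_cos_inner (δ : EuclideanSpace ℝ (Fin d)) :
    Integrable (fun v => Real.cos ⟪v, δ⟫_ℝ) π :=
  Integrable.of_mem_Icc (-1) 1 (by fun_prop)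
    (ae_of_all _ fun _ => ⟨Real.neg_one_le_cos _, Real.cos_le_one _⟩)

theorem abs_cosMean_le_one (δ : EuclideanSpace ℝ (Fin d)) : |cosMean π δ| ≤ 1 := by
  have h := norm_integral_le_of_norm_le_const (μ := π) (f := fun v => Real.cos ⟪v, δ⟫_ℝ)
    (C := 1) (ae_of_all _ fun v => Real.abs_cos_le_one _)
  rw [probReal_univ, mul_one, Real.norm_eq_abs] at h
  exact h

theorem sq_integral_norm_le (hσ : sigmaSq π ≠ ⊤) : (∫ v, ‖v‖ ∂π) ^ 2 ≤ (sigmaSq π).toReal := by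
  have h := variance_nonneg (fun v : EuclideanSpace ℝ (Fin d) => ‖v‖) π
  rw [variance_eq_sub (memLp_norm hσ)] at h
  rw [← integral_norm_sq]
  simpa using h

theorem abs_cosMean_sub_le (hσ : sigmaSq π ≠ ⊤) (δ δ' : EuclideanSpace ℝ (Fin d)) :
    |cosMean π δ - cosMean π δ'| ≤ (∫ v, ‖v‖ ∂π) * ‖δ - δ'‖ := by
  rw [cosMean, cosMean, ← integral_sub (integrable_cos_inner δ) (integrable_cos_inner δ'),
    ← integral_mul_const, ← Real.norm_eq_abs]
  refine norm_integral_le_of_norm_le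
    (((memLp_norm hσ).integrable (by norm_num)).mul_const _) (ae_of_all _ fun v => ?_)
  refine (Real.abs_cos_sub_cos_le _ _).trans ?_
  rw [← inner_sub_right]
  exact abs_real_inner_le_norm _ _

theorem one_sub_cos_inner_le (v : EuclideanSpace ℝ (Fin d)) {δ : EuclideanSpace ℝ (Fin d)}
    (hδ : ‖δ‖ ≤ 2) : 1 - Real.cos ⟪v, δ⟫_ℝ ≤ 2 * ‖v‖ ^ 2 := by
  have h1 := Real.one_sub_sq_div_two_le_cos (x := ⟪v, δ⟫_ℝ)
  have h2 : |⟪v, δ⟫_ℝ| ≤ ‖v‖ * 2 :=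
    (abs_real_inner_le_norm v δ).trans (mul_le_mul_of_nonneg_left hδ (norm_nonneg v))
  have h3 := sq_le_sq' (abs_le.1 h2).1 (abs_le.1 h2).2
  nlinarith

theorem one_sub_cosMean_le (hσ : sigmaSq π ≠ ⊤) {δ : EuclideanSpace ℝ (Fin d)}
    (hδ : ‖δ‖ ≤ 2) : 1 - cosMean π δ ≤ 2 * (sigmaSq π).toReal := by
  have h : ∫ v, (1 - Real.cos ⟪v, δ⟫_ℝ) ∂π ≤ ∫ v, 2 * ‖v‖ ^ 2 ∂π :=
    integral_mono ((integrable_const 1).sub (integrable_cos_inner δ))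
      ((integrable_norm_sq hσ).const_mul 2) fun v => one_sub_cos_inner_le v hδ
  rw [integral_sub (integrable_const 1) (integrable_cos_inner δ), integral_const_mul,
    integral_norm_sq] at h
  simpa [cosMean] using h

/-! ### Uniform concentration of the random features -/

variable {D : ℕ}

theorem abs_deviation_term_le (v δ : EuclideanSpace ℝ (Fin d)) :
    |Real.cos ⟪v, δ⟫_ℝ - cosMean π δ| ≤ 2 := by
  have h1 := abs_le.1 (Real.abs_cos_le_one ⟪v, δ⟫_ℝ)
  have h2 := abs_le.1 (abs_cosMean_le_one (π := π) δ)
  exact abs_le.2 ⟨by linarith, by linarith⟩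

/-- Hoeffding's inequality at one point. -/
theorem measureReal_le_abs_deviation {s : Finset (Fin D)} (hs : s.Nonempty) {a : ℝ} (ha : 0 ≤ a)
    (δ : EuclideanSpace ℝ (Fin d)) :
    (Measure.pi fun _ : Fin D => π).real {v | a ≤ |deviation π s v δ|} ≤
      2 * Real.exp (-a ^ 2 / (2 * D)) := by
  set ν := Measure.pi fun _ : Fin D => π with hν
  let X : Fin D → (Fin D → EuclideanSpace ℝ (Fin d)) → ℝ :=
    fun j v => Real.cos ⟪v j, δ⟫_ℝ - cosMean π δ
  have hindep : iIndepFun X ν :=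
    iIndepFun_pi (X := fun _ w => Real.cos ⟪w, δ⟫_ℝ - cosMean π δ) fun _ => by fun_prop
  have hmean : ∀ j, ∫ v, Real.cos ⟪v j, δ⟫_ℝ ∂ν = cosMean π δ := fun j =>
    integral_comp_eval (μ := fun _ : Fin D => π) (i := j)
      (integrable_cos_inner δ).aestronglyMeasurable
  have hsub : ∀ j, HasSubgaussianMGF (X j) 1 ν := by
    intro j
    have h := hasSubgaussianMGF_of_mem_Icc (μ := ν) (a := -1) (b := 1)
      (X := fun v => Real.cos ⟪v j, δ⟫_ℝ) (Measurable.aemeasurable (by fun_prop))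
      (ae_of_all _ fun _ => ⟨Real.neg_one_le_cos _, Real.cos_le_one _⟩)
    rw [hmean] at h
    convert! h using 1
    ext
    norm_num
  have hcard : (0 : ℝ) < s.card := Nat.cast_pos.2 hs.card_pos
  have hle : -a ^ 2 / (2 * ((∑ _j ∈ s, 1 : NNReal) : ℝ)) ≤ -a ^ 2 / (2 * D) := by
    have : (s.card : ℝ) ≤ D := by simpa using card_le_univ s
    rw [sum_const, nsmul_eq_mul, mul_one, NNReal.coe_natCast, neg_div, neg_div, neg_le_neg_iff]
    gcongr
  have h1 := (HasSubgaussianMGF.measure_sum_ge_le_of_iIndepFun hindep (s := s)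
    (fun j _ => hsub j) ha).trans (Real.exp_le_exp.2 hle)
  have h2 := (HasSubgaussianMGF.measure_sum_ge_le_of_iIndepFun (X := fun j v => -X j v)
    (hindep.comp (fun _ x => -x) fun _ => measurable_neg) (s := s)
    (fun j _ => (hsub j).neg) ha).trans (Real.exp_le_exp.2 hle)
  have h3 : {v | a ≤ |deviation π s v δ|} ⊆
      {v | a ≤ ∑ j ∈ s, X j v} ∪ {v | a ≤ ∑ j ∈ s, -X j v} := by
    intro v hv
    rcases le_abs.1 (Set.mem_ofPred.1 hv) with h | h
    · exact Or.inl h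
    · refine Or.inr ?_
      rwa [Set.mem_ofPred, sum_neg_distrib]
  linarith [(measureReal_mono h3 (measure_ne_top ν _)).trans (measureReal_union_le _ _)]

/-- Chebyshev's inequality for the Lipschitz constant of the deviation. -/
theorem measureReal_le_sum_norm (hσ : sigmaSq π ≠ ⊤) (s : Finset (Fin D)) {b r : ℝ} (hb : 0 < b) :
    (Measure.pi fun _ : Fin D => π).real {v | b ≤ r * ∑ j ∈ s, (‖v j‖ + ∫ w, ‖w‖ ∂π)} ≤
      4 * r ^ 2 * D ^ 2 * (sigmaSq π).toReal / b ^ 2 := by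
  set ν := Measure.pi fun _ : Fin D => π with hν
  set m := ∫ w, ‖w‖ ∂π with hm
  have hm0 : 0 ≤ m := integral_nonneg fun _ => norm_nonneg _
  let Y : (Fin D → EuclideanSpace ℝ (Fin d)) → ℝ :=
    fun v => 2 * r ^ 2 * D * ∑ j, (‖v j‖ ^ 2 + (sigmaSq π).toReal)
  have hint : ∀ j, Integrable (fun v : Fin D → EuclideanSpace ℝ (Fin d) => ‖v j‖ ^ 2) ν := fun j =>
    integrable_comp_eval (μ := fun _ : Fin D => π) (i := j) (integrable_norm_sq hσ)
  have hmean : ∀ j, ∫ v, ‖v j‖ ^ 2 ∂ν = (sigmaSq π).toReal := fun j => by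
    rw [← integral_norm_sq]
    exact integral_comp_eval (μ := fun _ : Fin D => π) (i := j)
      (f := fun w : EuclideanSpace ℝ (Fin d) => ‖w‖ ^ 2)
      (integrable_norm_sq hσ).aestronglyMeasurable
  have hYint : Integrable Y ν :=
    (integrable_finsetSum _ fun j _ => (hint j).add (integrable_const _)).const_mul _
  have hY : ∫ v, Y v ∂ν = 4 * r ^ 2 * D ^ 2 * (sigmaSq π).toReal := by
    simp only [Y]
    have h1 : ∀ j, ∫ v, (‖v j‖ ^ 2 + (sigmaSq π).toReal) ∂ν = 2 * (sigmaSq π).toReal := fun j => by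
      rw [integral_add (hint j) (integrable_const _), hmean]
      simp
      ring
    rw [integral_const_mul, integral_finsetSum _ fun j _ => ?_]
    · simp only [h1, sum_const, card_univ, Fintype.card_fin, nsmul_eq_mul]
      ring
    · exact (hint j).add (integrable_const _)
  have hY0 : ∀ v, 0 ≤ Y v := fun v => by
    have : 0 ≤ (sigmaSq π).toReal := ENNReal.toReal_nonneg
    simp only [Y]
    positivity
  have hsub : {v | b ≤ r * ∑ j ∈ s, (‖v j‖ + m)} ⊆ {v | b ^ 2 ≤ Y v} := by
    intro v hv
    have h1 : b ^ 2 ≤ (r * ∑ j ∈ s, (‖v j‖ + m)) ^ 2 := pow_le_pow_left₀ hb.le hv 2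
    have h2 : (∑ j ∈ s, (‖v j‖ + m)) ≤ ∑ j, (‖v j‖ + m) :=
      sum_le_sum_of_subset_of_nonneg (subset_univ s) fun j _ _ => by positivity
    have h3 : (∑ j, (‖v j‖ + m)) ^ 2 ≤ D * ∑ j, (‖v j‖ + m) ^ 2 := by
      simpa using sq_sum_le_card_mul_sum_sq (s := univ) (f := fun j => ‖v j‖ + m)
    have h4 : ∑ j, (‖v j‖ + m) ^ 2 ≤ 2 * ∑ j, (‖v j‖ ^ 2 + (sigmaSq π).toReal) := by
      rw [mul_sum]
      refine sum_le_sum fun j _ => ?_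
      have := sq_integral_norm_le hσ
      nlinarith [sq_nonneg (‖v j‖ - m)]
    calc b ^ 2 ≤ r ^ 2 * (∑ j ∈ s, (‖v j‖ + m)) ^ 2 := by rwa [← mul_pow]
      _ ≤ r ^ 2 * (∑ j, (‖v j‖ + m)) ^ 2 := by gcongr
      _ ≤ r ^ 2 * (D * (2 * ∑ j, (‖v j‖ ^ 2 + (sigmaSq π).toReal))) := by
          gcongr
          exact h3.trans (by gcongr)
      _ = Y v := by simp only [Y]; ring
  have h5 := mul_meas_ge_le_integral_of_nonneg (ae_of_all _ hY0) hYint (b ^ 2)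
  rw [le_div_iff₀ (by positivity), mul_comm, ← hY]
  exact (mul_le_mul_of_nonneg_left (measureReal_mono hsub (measure_ne_top ν _))
    (sq_nonneg b)).trans h5

/-- The `r`-net argument on the ball of radius `2`: a large deviation somewhere in the ball forces a
large deviation at a point of the net or a large Lipschitz constant. -/
theorem measureReal_exists_deviation_le (hσ : sigmaSq π ≠ ⊤) {s : Finset (Fin D)}
    (hs : s.Nonempty) {a b r : ℝ} (ha : 0 ≤ a) (hb : 0 < b) (hr : 0 < r) :
    (Measure.pi fun _ : Fin D => π).real {v | ∃ δ : EuclideanSpace ℝ (Fin d), ‖δ‖ ≤ 2 ∧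
      a + b ≤ |deviation π s v δ|} ≤
      (1 + 4 / r) ^ d * (2 * Real.exp (-a ^ 2 / (2 * D))) +
        4 * r ^ 2 * D ^ 2 * (sigmaSq π).toReal / b ^ 2 := by
  set ν := Measure.pi fun _ : Fin D => π with hν
  obtain ⟨N, hN, hcover⟩ := exists_net d (R := 2) zero_le_two hr
  have hsub : {v : Fin D → EuclideanSpace ℝ (Fin d) | ∃ δ : EuclideanSpace ℝ (Fin d), ‖δ‖ ≤ 2 ∧
      a + b ≤ |deviation π s v δ|} ⊆ (⋃ c ∈ N, {v | a ≤ |deviation π s v c|}) ∪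
      {v | b ≤ r * ∑ j ∈ s, (‖v j‖ + ∫ w, ‖w‖ ∂π)} := by
    rintro v ⟨δ, hδ, hv⟩
    obtain ⟨c, hc, hcδ⟩ := hcover δ hδ
    by_contra hcon
    simp only [Set.mem_union, Set.mem_iUnion, Set.mem_ofPred, not_or, not_exists, not_le] at hcon
    have h1 := hcon.1 c hc
    have h2 : |deviation π s v δ - deviation π s v c| ≤
        r * ∑ j ∈ s, (‖v j‖ + ∫ w, ‖w‖ ∂π) := by
      rw [deviation, deviation, ← sum_sub_distrib, mul_sum]
      refine (abs_sum_le_sum_abs _ _).trans (sum_le_sum fun j _ => ?_)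
      have h3 : |Real.cos ⟪v j, δ⟫_ℝ - Real.cos ⟪v j, c⟫_ℝ| ≤ ‖v j‖ * r := by
        refine (Real.abs_cos_sub_cos_le _ _).trans ?_
        rw [← inner_sub_right]
        exact (abs_real_inner_le_norm _ _).trans (mul_le_mul_of_nonneg_left hcδ (norm_nonneg _))
      have h4 := (abs_cosMean_sub_le hσ δ c).trans
        (mul_le_mul_of_nonneg_left hcδ (integral_nonneg fun _ => norm_nonneg _))
      rw [sub_sub_sub_comm]
      refine (abs_sub _ _).trans ?_
      linarith
    have h3 := abs_sub_abs_le_abs_sub (deviation π s v δ) (deviation π s v c)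
    linarith [hcon.2]
  refine (measureReal_mono hsub (measure_ne_top ν _)).trans ((measureReal_union_le _ _).trans
    (add_le_add ?_ (measureReal_le_sum_norm hσ s hb)))
  refine (measureReal_biUnion_finset_le N _).trans
    ((sum_le_sum fun c _ => measureReal_le_abs_deviation hs ha c).trans ?_)
  rw [sum_const, nsmul_eq_mul]
  norm_num at hN
  gcongr

/-- A deviation is not only unlikely by concentration, it also needs frequencies of norm
comparable to `√ε`. This gives the factor `σ² / ε`: on the event, the average of `2 ‖v_i‖²` is at
least `ε` (unless `2 σ² ≥ ε`), while deleting the `i`-th frequency makes the event independent of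
`v_i` and lowers the threshold by at most `2`. -/
theorem measure_exists_deviation_le_mul (hσ : sigmaSq π ≠ ⊤) (hD : 0 < D) {ε : ℝ} (hε : 0 < ε)
    (F : Finset (EuclideanSpace ℝ (Fin d))) (hF : ∀ δ ∈ F, ‖δ‖ ≤ 2) {q : ℝ≥0∞}
    (hq : ∀ i, (Measure.pi fun _ : Fin D => π)
      {v | ∃ δ ∈ F, D * ε - 2 ≤ |deviation π (univ.erase i) v δ|} ≤ q) :
    (Measure.pi fun _ : Fin D => π) {v | ∃ δ ∈ F, D * ε ≤ |deviation π univ v δ|} ≤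
      ENNReal.ofReal (2 / ε) * sigmaSq π * q := by
  classical
  set ν := Measure.pi fun _ : Fin D => π with hν
  set A := {v : Fin D → EuclideanSpace ℝ (Fin d) | ∃ δ ∈ F, D * ε ≤ |deviation π univ v δ|}
  let A' : Fin D → Set (Fin D → EuclideanSpace ℝ (Fin d)) :=
    fun i => {v | ∃ δ ∈ F, D * ε - 2 ≤ |deviation π (univ.erase i) v δ|}
  have hsub : ∀ i, A ⊆ A' i := by
    rintro i v ⟨δ, hδ, hv⟩
    refine ⟨δ, hδ, ?_⟩
    have h1 : deviation π univ v δ = (Real.cos ⟪v i, δ⟫_ℝ - cosMean π δ) +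
        deviation π (univ.erase i) v δ := (add_sum_erase univ _ (mem_univ i)).symm
    have h2 := abs_add_le (Real.cos ⟪v i, δ⟫_ℝ - cosMean π δ) (deviation π (univ.erase i) v δ)
    rw [← h1] at h2
    linarith [abs_deviation_term_le (π := π) (v i) δ]
  rcases le_or_gt ε (2 * (sigmaSq π).toReal) with hcase | hcase
  · have h1 : (1 : ℝ≥0∞) ≤ ENNReal.ofReal (2 / ε) * sigmaSq π := by
      rw [← ENNReal.ofReal_toReal hσ, ← ENNReal.ofReal_mul (by positivity), ← ENNReal.ofReal_one]
      refine ENNReal.ofReal_le_ofReal ?_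
      rw [div_mul_eq_mul_div, le_div_iff₀ hε]
      linarith
    calc ν A ≤ ν (A' ⟨0, hD⟩) := measure_mono (hsub _)
      _ ≤ 1 * q := by rw [one_mul]; exact hq _
      _ ≤ _ := by gcongr
  have hD' : (0 : ℝ) < D := Nat.cast_pos.2 hD
  have hmeasA' : ∀ i, MeasurableSet (A' i) := by
    intro i
    have : A' i = ⋃ δ ∈ F, {v | D * ε - 2 ≤ |deviation π (univ.erase i) v δ|} := by
      ext; simp [A']
    rw [this]
    refine F.measurableSet_biUnion fun δ _ => measurableSet_le measurable_const ?_
    fun_prop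
  have hmeasA : MeasurableSet A := by
    have : A = ⋃ δ ∈ F, {v | D * ε ≤ |deviation π univ v δ|} := by
      ext; simp [A]
    rw [this]
    refine F.measurableSet_biUnion fun δ _ => measurableSet_le measurable_const ?_
    fun_prop
  -- on `A` the squared norms of the frequencies sum up to at least `D ε / 2`
  have hbig : ∀ v ∈ A, D * ε ≤ 2 * ∑ i, ‖v i‖ ^ 2 := by
    rintro v ⟨δ, hδ, hv⟩
    have h1 : deviation π univ v δ = D * (1 - cosMean π δ) - ∑ i, (1 - Real.cos ⟪v i, δ⟫_ℝ) := by
      rw [deviation, sum_sub_distrib, sum_sub_distrib]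
      simp
      ring
    have h2 : ∑ i, (1 - Real.cos ⟪v i, δ⟫_ℝ) ≤ 2 * ∑ i, ‖v i‖ ^ 2 := by
      rw [mul_sum]
      exact sum_le_sum fun i _ => one_sub_cos_inner_le (v i) (hF δ hδ)
    have h3 : 0 ≤ ∑ i, (1 - Real.cos ⟪v i, δ⟫_ℝ) :=
      sum_nonneg fun i _ => sub_nonneg.2 (Real.cos_le_one _)
    have h4 := one_sub_cosMean_le hσ (hF δ hδ)
    have h5 := (abs_le.1 (abs_cosMean_le_one (π := π) δ)).2
    rcases le_abs.1 hv with h | h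
    · have : D * (1 - cosMean π δ) < D * ε := mul_lt_mul_of_pos_left (by linarith) hD'
      linarith
    · have : 0 ≤ D * (1 - cosMean π δ) := mul_nonneg hD'.le (by linarith)
      linarith
  have hpoint : ∀ v, A.indicator 1 v ≤ ENNReal.ofReal (2 / (D * ε)) *
      ∑ i, ‖v i‖ₑ ^ 2 * (A' i).indicator 1 v := by
    intro v
    by_cases hv : v ∈ A
    · have h1 : ∀ i, (A' i).indicator (1 : (Fin D → EuclideanSpace ℝ (Fin d)) → ℝ≥0∞) v = 1 :=
        fun i => Set.indicator_of_mem (hsub i hv) _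
      simp only [Set.indicator_of_mem hv, h1, mul_one, Pi.one_apply]
      have h2 : ∑ i, ‖v i‖ₑ ^ 2 = ENNReal.ofReal (∑ i, ‖v i‖ ^ 2) := by
        rw [ENNReal.ofReal_sum_of_nonneg fun i _ => sq_nonneg _]
        refine sum_congr rfl fun i _ => ?_
        rw [ENNReal.ofReal_pow (norm_nonneg _), ofReal_norm]
      rw [h2, ← ENNReal.ofReal_mul (by positivity), ← ENNReal.ofReal_one]
      refine ENNReal.ofReal_le_ofReal ?_
      rw [div_mul_eq_mul_div, le_div_iff₀ (by positivity)]
      linarith [hbig v hv]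
    · rw [Set.indicator_of_notMem hv]
      exact zero_le
  have hfac : ∀ i, ∫⁻ v, ‖v i‖ₑ ^ 2 * (A' i).indicator 1 v ∂ν = sigmaSq π * ν (A' i) := by
    intro i
    have hcoord : iIndepFun (fun j (v : Fin D → EuclideanSpace ℝ (Fin d)) => v j) ν :=
      iIndepFun_pi (X := fun _ w => w) fun _ => aemeasurable_id
    have hind := hcoord.indepFun_finset {i} (univ.erase i)
      (by simp) fun j => measurable_pi_apply j
    let B : Set (↥(univ.erase i) → EuclideanSpace ℝ (Fin d)) :=
      {w | ∃ δ ∈ F, D * ε - 2 ≤ |∑ j, (Real.cos ⟪w j, δ⟫_ℝ - cosMean π δ)|}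
    have hB : MeasurableSet B := by
      have : B = ⋃ δ ∈ F, {w | D * ε - 2 ≤ |∑ j, (Real.cos ⟪w j, δ⟫_ℝ - cosMean π δ)|} := by
        ext; simp [B]
      rw [this]
      refine F.measurableSet_biUnion fun δ _ => measurableSet_le measurable_const ?_
      fun_prop
    have hAB : ∀ v, (A' i).indicator (1 : (Fin D → EuclideanSpace ℝ (Fin d)) → ℝ≥0∞) v =
        B.indicator 1 (fun j : ↥(univ.erase i) => v j) := by
      intro v
      have : v ∈ A' i ↔ (fun j : ↥(univ.erase i) => v j) ∈ B := by
        simp only [A', B, Set.mem_ofPred, deviation]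
        refine exists_congr fun δ => and_congr_right fun _ => ?_
        rw [← sum_coe_sort (univ.erase i)]
      simp only [Set.indicator, this, Pi.one_apply]
    have h1 : Measurable fun w : ↥({i} : Finset (Fin D)) → EuclideanSpace ℝ (Fin d) =>
        ‖w ⟨i, mem_singleton_self i⟩‖ₑ ^ 2 := by fun_prop
    have h2 := hind.comp h1 (measurable_one.indicator hB : Measurable
      (B.indicator (1 : (↥(univ.erase i) → EuclideanSpace ℝ (Fin d)) → ℝ≥0∞)))
    have h3 : IndepFun (fun v => ‖v i‖ₑ ^ 2)
        ((A' i).indicator (1 : (Fin D → EuclideanSpace ℝ (Fin d)) → ℝ≥0∞)) ν := by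
      have h4 : (A' i).indicator (1 : (Fin D → EuclideanSpace ℝ (Fin d)) → ℝ≥0∞) =
          B.indicator 1 ∘ fun v (j : ↥(univ.erase i)) => v j := funext hAB
      rw [h4]
      exact h2
    have h5 : Measurable fun v : Fin D → EuclideanSpace ℝ (Fin d) => ‖v i‖ₑ ^ 2 := by fun_prop
    refine (lintegral_mul_eq_lintegral_mul_lintegral_of_indepFun'' h5.aemeasurable
      (measurable_one.indicator (hmeasA' i)).aemeasurable h3).trans ?_
    rw [lintegral_indicator_one (hmeasA' i)]
    congr 1
    exact (measurePreserving_eval (fun _ : Fin D => π) i).lintegral_comp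
      (f := fun w : EuclideanSpace ℝ (Fin d) => ‖w‖ₑ ^ 2) (by fun_prop)
  calc ν A = ∫⁻ v, A.indicator 1 v ∂ν := (lintegral_indicator_one hmeasA).symm
    _ ≤ ∫⁻ v, ENNReal.ofReal (2 / (D * ε)) * ∑ i, ‖v i‖ₑ ^ 2 * (A' i).indicator 1 v ∂ν :=
        lintegral_mono hpoint
    _ = ENNReal.ofReal (2 / (D * ε)) * ∑ i, sigmaSq π * ν (A' i) := by
        rw [lintegral_const_mul', lintegral_finsetSum]
        · simp only [hfac]
        · intro i _
          exact Measurable.mul (by fun_prop) (measurable_one.indicator (hmeasA' i))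
        · exact ENNReal.ofReal_ne_top
    _ ≤ ENNReal.ofReal (2 / (D * ε)) * ∑ _i : Fin D, sigmaSq π * q := by
        gcongr with i
        exact hq i
    _ = ENNReal.ofReal (2 / ε) * sigmaSq π * q := by
        rw [sum_const, card_univ, Fintype.card_fin, nsmul_eq_mul, ← ENNReal.ofReal_natCast,
          ← mul_assoc, ← mul_assoc, ← ENNReal.ofReal_mul (by positivity)]
        congr 3
        field_simp

end Deviation

end Raker

/-! ### The failure probability -/

namespace Raker

theorem two_le_of_exp_neg_le {q : ℝ} (hq : Real.exp (-q) ≤ 1 / 8) : 2 ≤ q := by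
  by_contra! h
  have h1 : Real.exp (-2) < Real.exp (-q) := Real.exp_lt_exp.2 (by linarith)
  have h2 : Real.exp (-2) * Real.exp 2 = 1 := by rw [← Real.exp_add]; simp
  have h3 : Real.exp 2 = Real.exp 1 * Real.exp 1 := by rw [← Real.exp_add]; norm_num
  nlinarith [Real.exp_one_lt_d9, Real.exp_pos 1, Real.exp_pos 2]

/-- Elementary estimate behind the choice of the mesh `r = 4 g / u` of the net, where
`g = exp (-q)`: the exponential gain beats the size of the net as soon as `g u ≤ 1`. -/
theorem net_size_mul_exp_le {d : ℕ} {q u : ℝ} (hq : Real.exp (-q) ≤ 1 / 8)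
    (hu : u * Real.exp (-q) ≤ 1) (hu0 : 0 < u) :
    (1 + u / Real.exp (-q)) ^ d * Real.exp (-(9 / 4 * (d + 2) * q)) ≤ Real.exp (-q) ^ 2 := by
  set g := Real.exp (-q) with hg
  have hg0 : 0 < g := Real.exp_pos _
  have hq2 : 2 ≤ q := two_le_of_exp_neg_le hq
  have hexp : Real.exp (-(9 / 4 * q)) = g ^ 2 * Real.exp (-(q / 4)) := by
    rw [hg, ← Real.exp_nat_mul, ← Real.exp_add]
    congr 1
    push_cast
    ring
  have hquarter : Real.exp (-(q / 4)) * (3 / 2) ≤ 1 := by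
    rw [Real.exp_neg, ← div_eq_inv_mul, div_le_one (Real.exp_pos _)]
    linarith [Real.add_one_le_exp (q / 4)]
  have hbase : (1 + u / g) * Real.exp (-(9 / 4 * q)) ≤ 1 := by
    have h1 : (1 + u / g) * (g ^ 2 * Real.exp (-(q / 4))) =
        (g ^ 2 + u * g) * Real.exp (-(q / 4)) := by field_simp
    rw [hexp, h1]
    nlinarith [Real.exp_pos (-(q / 4))]
  have hlast : Real.exp (-(9 / 2 * q)) ≤ g ^ 2 := by
    rw [hg, ← Real.exp_nat_mul]
    refine Real.exp_le_exp.2 ?_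
    push_cast
    linarith
  have hsplit : Real.exp (-(9 / 4 * (d + 2) * q)) =
      Real.exp (-(9 / 4 * q)) ^ d * Real.exp (-(9 / 2 * q)) := by
    rw [← Real.exp_nat_mul, ← Real.exp_add]
    congr 1
    ring
  rw [hsplit, ← mul_assoc, ← mul_pow]
  have h2 : ((1 + u / g) * Real.exp (-(9 / 4 * q))) ^ d ≤ 1 := pow_le_one₀ (by positivity) hbase
  nlinarith [Real.exp_pos (-(9 / 2 * q))]

section

variable {d D : ℕ} {π : Measure (EuclideanSpace ℝ (Fin d))} [IsProbabilityMeasure π]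

/-- With one frequency deleted, a deviation of `D ε - 2` somewhere in the ball of radius `2` has
probability at most `18 g²`, where `g² = exp (-D ε² / (4 d + 8))`. Of the threshold, which is at
least `(7 / 8) D ε`, the part `(3 / 4) D ε` goes to Hoeffding's inequality and the rest to the
Lipschitz constant. -/
theorem measure_exists_deviation_erase_le (hσ : sigmaSq π ≠ ⊤) {ε g : ℝ} (hε : 0 < ε)
    (hε2 : ε ≤ 2) (hg : g = Real.exp (-(D * ε ^ 2 / (8 * (d + 2))))) (hg8 : g ≤ 1 / 8)
    (hσg : 256 * ((sigmaSq π).toReal / ε ^ 2) * g ^ 2 ≤ 1) (i : Fin D) :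
    (Measure.pi fun _ : Fin D => π) {v | ∃ δ : EuclideanSpace ℝ (Fin d), ‖δ‖ ≤ 2 ∧
      D * ε - 2 ≤ |deviation π (univ.erase i) v δ|} ≤ ENNReal.ofReal (18 * g ^ 2) := by
  set q := D * ε ^ 2 / (8 * ((d : ℝ) + 2)) with hq
  set S := (sigmaSq π).toReal / ε ^ 2 with hS
  have hS0 : 0 ≤ S := div_nonneg ENNReal.toReal_nonneg (sq_nonneg ε)
  have hg0 : 0 < g := hg ▸ Real.exp_pos _
  have hD0 : (0 : ℝ) < D := Nat.cast_pos.2 i.pos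
  have hqD : q * (8 * (d + 2)) = D * ε ^ 2 := by rw [hq]; field_simp
  have hq2 : 2 ≤ q := two_le_of_exp_neg_le (hg ▸ hg8)
  have hDε : 16 ≤ D * ε := by
    have h1 : 32 ≤ D * ε ^ 2 := by
      rw [← hqD]
      have : (0 : ℝ) ≤ d := Nat.cast_nonneg d
      nlinarith
    nlinarith [mul_pos hD0 hε]
  have hne : (univ.erase i : Finset (Fin D)).Nonempty := by
    rw [← card_pos, card_erase_of_mem (mem_univ i), card_univ, Fintype.card_fin]
    have : (2 : ℝ) ≤ D := by nlinarith
    have : 2 ≤ D := by exact_mod_cast this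
    omega
  set u := max 8 (16 * √S) with hu
  have hu8 : 8 ≤ u := le_max_left _ _
  have hug : u * g ≤ 1 := by
    rw [hu, max_mul_of_nonneg _ _ hg0.le]
    refine max_le (by linarith) ?_
    refine le_of_sq_le_sq ?_ zero_le_one
    rw [mul_pow, mul_pow, Real.sq_sqrt hS0]
    linarith
  have huS : 256 * S ≤ u ^ 2 := by
    have h1 := pow_le_pow_left₀ (by positivity) (le_max_right 8 (16 * √S)) 2
    rw [mul_pow, Real.sq_sqrt hS0] at h1
    linarith
  have hnet := measureReal_exists_deviation_le hσ hne (a := 3 / 4 * (D * ε))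
    (b := 1 / 8 * (D * ε)) (r := 4 * g / u) (by positivity) (by positivity) (by positivity)
  have hexp : -(3 / 4 * (D * ε)) ^ 2 / (2 * D) = -(9 / 4 * (d + 2) * q) := by
    rw [hq]
    field_simp
    ring
  have hmesh : 4 / (4 * g / u) = u / g := by field_simp
  have hsecond : 4 * (4 * g / u) ^ 2 * D ^ 2 * (sigmaSq π).toReal / (1 / 8 * (D * ε)) ^ 2 ≤
      16 * g ^ 2 := by
    have h1 : 4 * (4 * g / u) ^ 2 * D ^ 2 * (sigmaSq π).toReal / (1 / 8 * (D * ε)) ^ 2 =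
        16 * g ^ 2 * (256 * S / u ^ 2) := by
      rw [hS]
      field_simp
      ring
    rw [h1]
    exact mul_le_of_le_one_right (by positivity) ((div_le_one (by positivity)).2 huS)
  have hfirst := net_size_mul_exp_le (d := d) (q := q) (u := u) (hg ▸ hg8) (hg ▸ hug)
    (by linarith)
  rw [← hg] at hfirst
  rw [hexp, hmesh] at hnet
  rw [← ofReal_measureReal]
  refine ENNReal.ofReal_le_ofReal ((measureReal_mono ?_).trans (hnet.trans (by linarith)))
  rintro v ⟨δ, hδ, hv⟩
  exact ⟨δ, hδ, by linarith⟩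

/-- The random features reproduce the kernel up to `ε` on pairs of points of the unit ball, except
on an event of probability at most `failProb π D ε`. -/
theorem measure_exists_deviation_le_failProb (hσ : sigmaSq π ≠ ⊤) (hD : 0 < D) {ε : ℝ}
    (hε : 0 < ε) (F : Finset (EuclideanSpace ℝ (Fin d))) (hF : ∀ δ ∈ F, ‖δ‖ ≤ 2) :
    (Measure.pi fun _ : Fin D => π) {v | ∃ δ ∈ F, D * ε < |deviation π univ v δ|} ≤
      failProb π D ε := by
  set ν := Measure.pi fun _ : Fin D => π with hν
  have hD0 : (0 : ℝ) < D := Nat.cast_pos.2 hD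
  rcases lt_or_ge 2 ε with hε2 | hε2
  · have hempty : {v : Fin D → EuclideanSpace ℝ (Fin d) |
        ∃ δ ∈ F, D * ε < |deviation π univ v δ|} = ∅ := by
      refine Set.eq_empty_of_forall_notMem ?_
      rintro v ⟨δ, -, hv⟩
      have h1 : |deviation π univ v δ| ≤ D * 2 := by
        refine (abs_sum_le_sum_abs _ _).trans ((sum_le_sum fun j _ =>
          abs_deviation_term_le (v j) δ).trans ?_)
        simp
      nlinarith
    rw [hempty, measure_empty]
    exact zero_le
  set g := Real.exp (-(D * ε ^ 2 / (8 * ((d : ℝ) + 2)))) with hg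
  set S := (sigmaSq π).toReal / ε ^ 2 with hS
  have hS0 : 0 ≤ S := div_nonneg ENNReal.toReal_nonneg (sq_nonneg ε)
  have hg0 : 0 < g := Real.exp_pos _
  have hfail : failProb π D ε = ENNReal.ofReal (256 * S * g ^ 2) := by
    have h1 : Real.exp (-(D * ε ^ 2) / (4 * d + 8)) = g ^ 2 := by
      rw [hg, ← Real.exp_nat_mul]
      congr 1
      field_simp
      ring
    rw [failProb, h1, ← ENNReal.ofReal_toReal hσ, ← ENNReal.ofReal_div_of_pos (by positivity),
      ENNReal.ofReal_mul (by positivity), ENNReal.ofReal_mul (by positivity), ← hS]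
    norm_num
  rcases le_or_gt 1 (256 * S * g ^ 2) with h1 | h1
  · rw [hfail]
    exact prob_le_one.trans (by simpa using ENNReal.ofReal_le_ofReal h1)
  have hmul : ∀ {c : ℝ}, 0 ≤ c → c ≤ 64 * g ^ 2 →
      (∀ i, ν {v | ∃ δ ∈ F, D * ε - 2 ≤ |deviation π (univ.erase i) v δ|} ≤
        ENNReal.ofReal c) →
      ν {v | ∃ δ ∈ F, D * ε < |deviation π univ v δ|} ≤ failProb π D ε := by
    intro c hc0 hc hQ
    calc ν {v | ∃ δ ∈ F, D * ε < |deviation π univ v δ|}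
        ≤ ν {v | ∃ δ ∈ F, D * ε ≤ |deviation π univ v δ|} :=
          measure_mono fun v ⟨δ, hδ, hv⟩ => ⟨δ, hδ, hv.le⟩
      _ ≤ ENNReal.ofReal (2 / ε) * sigmaSq π * ENNReal.ofReal c :=
          measure_exists_deviation_le_mul hσ hD hε F hF hQ
      _ = ENNReal.ofReal (2 / ε * (sigmaSq π).toReal * c) := by
          conv_lhs => rw [← ENNReal.ofReal_toReal hσ]
          rw [← ENNReal.ofReal_mul (by positivity), ← ENNReal.ofReal_mul (by positivity)]
      _ ≤ failProb π D ε := by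
          rw [hfail]
          refine ENNReal.ofReal_le_ofReal ?_
          have h2 : 2 / ε * (sigmaSq π).toReal = 2 * ε * S := by
            rw [hS]
            field_simp
          rw [h2]
          calc 2 * ε * S * c ≤ 2 * 2 * S * (64 * g ^ 2) := by gcongr
            _ = 256 * S * g ^ 2 := by ring
  -- The factor `σ² / ε` suffices for small `D`; for large `D` it is combined with the net.
  rcases le_or_gt g (1 / 8) with hg8 | hg8
  · refine hmul (by positivity) (by nlinarith : 18 * g ^ 2 ≤ 64 * g ^ 2) fun i => ?_
    refine (measure_mono ?_).trans
      (measure_exists_deviation_erase_le hσ hε hε2 hg hg8 h1.le i)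
    rintro v ⟨δ, hδ, hv⟩
    exact ⟨δ, hF δ hδ, hv⟩
  · refine hmul zero_le_one (by nlinarith : 1 ≤ 64 * g ^ 2) fun i => ?_
    rw [ENNReal.ofReal_one]
    exact prob_le_one

end

/-! ### The regret of Raker -/

theorem IsSpectral.eq_cosMean {d : ℕ}
    {κ : EuclideanSpace ℝ (Fin d) → EuclideanSpace ℝ (Fin d) → ℝ}
    {π : Measure (EuclideanSpace ℝ (Fin d))} (h : IsSpectral κ π) (x x' : EuclideanSpace ℝ (Fin d)) :
    κ x x' = cosMean π (x - x') := by
  have := h.1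
  have h1 : Integrable (fun v => Complex.exp (⟪v, x - x'⟫_ℝ * Complex.I)) π := by
    refine Integrable.of_bound (by fun_prop) 1 (ae_of_all _ fun v => ?_)
    rw [Complex.norm_exp_ofReal_mul_I]
  have h2 := congrArg Complex.re (h.2 x x')
  rw [charFun_apply, Complex.ofReal_re, ← RCLike.re_eq_complex_re, ← integral_re h1] at h2
  rw [← h2, cosMean]
  refine integral_congr_ae (ae_of_all _ fun v => ?_)
  simp [Complex.exp_ofReal_mul_I_re]

/-- A pointwise consequence of the uniform approximation of the kernel holds with probability at
least `1 - failProb π D ε`. -/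
theorem one_sub_failProb_le {d D T : ℕ} (hD : 0 < D) {x : ℕ → EuclideanSpace ℝ (Fin d)}
    (hx : ∀ t < T, ‖x t‖ ≤ 1) {κ : EuclideanSpace ℝ (Fin d) → EuclideanSpace ℝ (Fin d) → ℝ}
    {π : Measure (EuclideanSpace ℝ (Fin d))} (hκ : IsSpectral κ π)
    {S : Type*} [MeasurableSpace S] {μ : Measure S} [IsProbabilityMeasure μ]
    {V : Fin D → S → EuclideanSpace ℝ (Fin d)} (hV : ∀ i, HasLaw (V i) π μ)
    (hind : iIndepFun V μ) {ε : ℝ} (hε : 0 < ε) {G : Set S}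
    (hG : ∀ᵐ ω ∂μ, (∀ s < T, ∀ t < T, |⟪features (fun i => V i ω) (x s),
      features (fun i => V i ω) (x t)⟫_ℝ - κ (x t) (x s)| ≤ ε) → ω ∈ G) :
    1 - failProb π D ε ≤ μ G := by
  classical
  have := hκ.1
  have hD0 : (0 : ℝ) < D := Nat.cast_pos.2 hD
  by_cases hσ : sigmaSq π = ⊤
  · have h1 : failProb π D ε = ⊤ := by
      rw [failProb, hσ, ENNReal.top_div_of_ne_top ENNReal.ofReal_ne_top,
        ENNReal.mul_top (by norm_num), ENNReal.top_mul]
      exact (ENNReal.ofReal_pos.2 (Real.exp_pos _)).ne'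
    rw [h1]
    simp
  let F : Finset (EuclideanSpace ℝ (Fin d)) :=
    (range T ×ˢ range T).image fun st => x st.1 - x st.2
  have hF : ∀ δ ∈ F, ‖δ‖ ≤ 2 := by
    intro δ hδ
    obtain ⟨st, hst, rfl⟩ := mem_image.1 hδ
    rw [mem_product, mem_range, mem_range] at hst
    have := norm_sub_le (x st.1) (x st.2)
    linarith [hx _ hst.1, hx _ hst.2]
  let A : Set (Fin D → EuclideanSpace ℝ (Fin d)) := {v | ∃ δ ∈ F, D * ε < |deviation π univ v δ|}
  have hA : MeasurableSet A := by
    have : A = ⋃ δ ∈ F, {v | D * ε < |deviation π univ v δ|} := by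
      ext; simp [A]
    rw [this]
    refine F.measurableSet_biUnion fun δ _ => measurableSet_lt measurable_const ?_
    fun_prop
  have hmap : μ.map (fun ω i => V i ω) = Measure.pi fun _ => π := by
    rw [(iIndepFun_iff_map_fun_eq_pi_map fun i => (hV i).aemeasurable).1 hind]
    simp_rw [(hV _).map_eq]
  have hbad : μ ((fun ω i => V i ω) ⁻¹' A) ≤ failProb π D ε := by
    rw [← Measure.map_apply_of_aemeasurable
      (aemeasurable_pi_lambda _ fun i => (hV i).aemeasurable) hA, hmap]
    exact measure_exists_deviation_le_failProb hσ hD hε F hF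
  rw [tsub_le_iff_right]
  have hcover : ∀ᵐ ω ∂μ, ω ∈ (Set.univ : Set S) → ω ∈ G ∪ (fun ω i => V i ω) ⁻¹' A := by
    filter_upwards [hG] with ω hω _
    by_contra hcon
    rw [Set.mem_union, not_or] at hcon
    refine hcon.1 (hω fun s hs t ht => ?_)
    by_contra! hlt
    refine hcon.2 ⟨x t - x s, mem_image.2 ⟨(t, s), by simp [hs, ht], rfl⟩, ?_⟩
    have h1 : ⟪features (fun i => V i ω) (x s), features (fun i => V i ω) (x t)⟫_ℝ -
        κ (x t) (x s) = (D : ℝ)⁻¹ * deviation π univ (fun i => V i ω) (x t - x s) := by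
      rw [real_inner_comm, inner_features, hκ.eq_cosMean, deviation, sum_sub_distrib]
      simp
      field_simp
    rw [h1, abs_mul, abs_of_pos (inv_pos.2 hD0), ← div_eq_inv_mul, lt_div_iff₀ hD0] at hlt
    linarith
  calc (1 : ℝ≥0∞) = μ Set.univ := measure_univ.symm
    _ ≤ μ (G ∪ (fun ω i => V i ω) ⁻¹' A) := measure_mono_ae hcover
    _ ≤ μ G + failProb π D ε := (measure_union_le _ _).trans (by gcongr)

/-- The regret bound with `ε = η` of order `1 / √T`. -/
theorem regretBound_le {P T : ℕ} {L C η a b : ℝ} (hη : 0 < η) (ha : 0 < a) (hT : 1 ≤ T)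
    (hP : 0 < P) (h1 : a / √T ≤ η) (h2 : η ≤ b / √T) :
    regretBound P T L C η η ≤
      (Real.log P / a + C ^ 2 / (2 * a) + C ^ 2 / 2 + b * L ^ 2 / 2 + b + b * |L * C|) * √T := by
  have hT' : (1 : ℝ) ≤ T := by exact_mod_cast hT
  set r := √(T : ℝ) with hr
  have hr1 : 1 ≤ r := Real.one_le_sqrt.2 hT'
  have hr0 : 0 < r := by linarith
  have hrT : (T : ℝ) = r * r := (Real.mul_self_sqrt (by linarith)).symm
  have hinv : 1 / η ≤ r / a := by
    rw [div_le_div_iff₀ hη ha]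
    rw [div_le_iff₀ hr0] at h1
    linarith
  have hηT : η * T ≤ b * r := by
    rw [hrT]
    rw [le_div_iff₀ hr0] at h2
    nlinarith
  have hlog : 0 ≤ Real.log P := Real.log_nonneg (by exact_mod_cast hP)
  have e1 := mul_le_mul_of_nonneg_left hinv hlog
  have e2 := mul_le_mul_of_nonneg_left hinv (by positivity : 0 ≤ C ^ 2 / 2)
  have e3 := mul_le_mul_of_nonneg_left hr1 (by positivity : 0 ≤ C ^ 2 / 2)
  have e4 := mul_le_mul_of_nonneg_right hηT (by positivity : 0 ≤ L ^ 2 / 2)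
  have e5 := mul_le_mul_of_nonneg_right hηT (abs_nonneg (L * C))
  have e6 : η * T * (L * C) ≤ η * T * |L * C| :=
    mul_le_mul_of_nonneg_left (le_abs_self _) (by positivity)
  have h3 : regretBound P T L C η η = Real.log P * (1 / η) + C ^ 2 / 2 * (1 / η) +
      C ^ 2 / 2 * 1 + η * T * (L ^ 2 / 2) + η * T + η * T * (L * C) := by
    rw [regretBound]
    field_simp
    ring
  have h4 : (Real.log P / a + C ^ 2 / (2 * a) + C ^ 2 / 2 + b * L ^ 2 / 2 + b + b * |L * C|) * r =
      Real.log P * (r / a) + C ^ 2 / 2 * (r / a) + C ^ 2 / 2 * r + b * r * (L ^ 2 / 2) + b * r +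
        b * r * |L * C| := by
    field_simp
  rw [h3, h4]
  linarith

end Raker

theorem theorem1 :
    ∃ c₀ : ℕ → ℝ → ℝ → ℝ → ℝ → ℝ,
    ∀ (d P D T : ℕ) (_ : 0 < P) (_ : 0 < D)
      -- the learning task, with convex and bounded losses and inputs in the unit ball
      (M : Raker.Task d) (L Cθ : ℝ)
      (_ : M.ConvexLoss T)
      (_ : M.BoundedLoss D T L Cθ)
      (_ : ∀ t < T, ‖M.x t‖ ≤ 1)
      -- the dictionary of kernels, with the RKHS and the spectral distribution of each
      (κ : Fin P → EuclideanSpace ℝ (Fin d) → EuclideanSpace ℝ (Fin d) → ℝ)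
      (_ : ∀ p, Raker.StandardKernel (κ p))
      (H : Fin P → Type*) [∀ p, NormedAddCommGroup (H p)] [∀ p, InnerProductSpace ℝ (H p)]
      [∀ p, CompleteSpace (H p)] [∀ p, RKHS ℝ (H p) (EuclideanSpace ℝ (Fin d)) ℝ]
      (_ : ∀ p x x', RKHS.kernel (H p) x x' 1 = κ p x x')
      (π : Fin P → Measure (EuclideanSpace ℝ (Fin d)))
      (_ : ∀ p, Raker.IsSpectral (κ p) (π p))
      -- the random features: for each kernel, `D` independent samples of its spectral distribution
      (S : Type*) [MeasurableSpace S] (μ : Measure S) [IsProbabilityMeasure μ]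
      (V : Fin P → Fin D → S → EuclideanSpace ℝ (Fin d))
      (_ : ∀ p i, HasLaw (V p i) (π p) μ)
      (_ : ∀ p, iIndepFun (V p) μ)
      -- the step size, and the requirement that the iterates stay where the losses are bounded
      (η ε : ℝ) (_ : 0 < η) (_ : 0 < ε)
      (_ : ∀ᵐ ω ∂μ, ∀ p, ∀ t < T, ‖M.theta (fun i => V p i ω) η t‖ ≤ Cθ)
      -- the best function in hindsight of each RKHS, and its kernel expansion
      (fstar : ∀ p, H p)
      (_ : ∀ p, IsMinOn (fun f : H p => M.rkhsTotal T f) Set.univ (fstar p))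
      (α : Fin P → ℕ → ℝ)
      (_ : ∀ p, fstar p = ∑ t ∈ range T, α p t • RKHS.kerFun (H p) (M.x t) (1 : ℝ))
      (C : ℝ) (_ : ∀ p, ∑ t ∈ range T, |α p t| ≤ C) (_ : C ≤ Cθ),
      -- regret relative to the best function of each single RKHS
      (∀ p, 1 - Raker.failProb (π p) D ε ≤
        μ {ω | M.rakerTotal (fun q i => V q i ω) η T - M.rkhsTotal T (fstar p) ≤
          Raker.regretBound P T L C η ε}) ∧
      -- regret relative to the best single-kernel function, whose kernel is number `p`
      (∀ p, (∀ q, M.rkhsTotal T (fstar p) ≤ M.rkhsTotal T (fstar q)) →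
        1 - Raker.failProb (π p) D ε ≤
          μ {ω | M.rakerTotal (fun q i => V q i ω) η T - ⨅ q, M.rkhsTotal T (fstar q) ≤
            Raker.regretBound P T L C η ε}) ∧
      -- static regret `O(√T)` when `η = ε` is of order `1 / √T`
      (∀ a b : ℝ, 0 < a → 1 ≤ T → ε = η → a / Real.sqrt T ≤ η → η ≤ b / Real.sqrt T →
        ∀ p, (∀ q, M.rkhsTotal T (fstar p) ≤ M.rkhsTotal T (fstar q)) →
          1 - Raker.failProb (π p) D ε ≤
            μ {ω | M.rakerTotal (fun q i => V q i ω) η T - ⨅ q, M.rkhsTotal T (fstar q) ≤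
              c₀ P L C a b * Real.sqrt T}) := by
  refine ⟨fun P L C a b => Real.log P / a + C ^ 2 / (2 * a) + C ^ 2 / 2 + b * L ^ 2 / 2 + b +
    b * |L * C|, ?_⟩
  intro d P D T hP hD M L Cθ hM hB hx κ _ H _ _ _ _ hκ π hπ S _ μ _ V hV hind η ε hη hε hθ fstar _
    α hα C hC hCθ
  have main : ∀ p, ∀ G : Set S, (∀ ω, M.rakerTotal (fun q i => V q i ω) η T -
      M.rkhsTotal T (fstar p) ≤ Raker.regretBound P T L C η ε → ω ∈ G) →
      1 - Raker.failProb (π p) D ε ≤ μ G := by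
    intro p G hG
    refine Raker.one_sub_failProb_le hD hx (hπ p) (hV p) (hind p) hε ?_
    filter_upwards [hθ] with ω hω hK
    exact hG ω (Raker.Task.rakerTotal_sub_rkhsTotal_le hM hD hB hε.le hη (fun q i => V q i ω) hω p
      (hκ p) (hα p) (hC p) hCθ hK)
  have hinf : ∀ p, (∀ q, M.rkhsTotal T (fstar p) ≤ M.rkhsTotal T (fstar q)) →
      ⨅ q, M.rkhsTotal T (fstar q) = M.rkhsTotal T (fstar p) := by
    intro p hp
    have : Nonempty (Fin P) := ⟨p⟩
    exact le_antisymm (ciInf_le (Set.finite_range _).bddBelow p) (le_ciInf hp)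
  refine ⟨fun p => main p _ fun ω h => h, fun p hp => main p _ fun ω h => ?_,
    fun a b ha hT hεη h1 h2 p hp => main p _ fun ω h => ?_⟩
  · rw [Set.mem_ofPred, hinf p hp]
    exact h
  · rw [Set.mem_ofPred, hinf p hp]
    subst hεη
    exact h.trans (Raker.regretBound_le hη ha hT hP h1 h2)
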